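/- Let $V$ be a finite-dimensional real inner product space and let $W$ be a finite reflection group on $V$, i.e. a finite group of orthogonal transformations of $V$ generated by reflections in hyperplanes through the origin. Consider the arrangement of all hyperplanes $H$ through the origin whose reflection $s_H$ lies in $W$. Its faces are the nonempty sets obtained by choosing, for each $H$, either $H$ or one of the two open half-spaces bounded by $H$, and intersecting the choices. They are ordered by $F\le G$ iff, for each $H$, either $F\subseteq H$ or $F$ and $G$ lie strictly on the same side of $H$. The faces are the simplices of the Coxeter complex $\Sigma$ of $W$: the smallest face is the empty simplex, the minimal faces above it are the vertices, and the vertices of a simplex $F$ are the vertices $v\le F$. The chambers are the faces contained in no $H$. The codimension of a face is that of its support, the intersection of the hyperplanes of the arrangement that contain it. Fix a chamber $C$ and let $r$ be its number of vertices. A labelling of $\Sigma$ is a map $\tau$ from the vertices of $\Sigma$ to a set $I$ with $r$ elements such that distinct vertices of a common simplex have distinct images; $\operatorname{type}(F)\subseteq I$ denotes the set of labels of the vertices of $F$. Two distinct chambers are adjacent if they have a common face of codimension one, and $i$-adjacent if they have a common face of codimension one and of type $I\setminus\{i\}$. A gallery is a sequence of successively adjacent chambers, and it is minimal if it has the least possible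 length among the galleries with the same ends. The descent set $\operatorname{des}(C,C')$ of a chamber $C'$ is the set of $i\in I$ such that some minimal gallery from $C$ to $C'$ ends with an $i$-adjacency; for $w\in W$ put $\operatorname{des}(w)=\operatorname{des}(C,wC)$. For $J\subseteq I$ let $f_J(\Sigma)$ be the number of simplices of type $J$, and let $$h_J(\Sigma)=\sum_{K\subseteq J}(-1)^{|J\setminus K|}f_K(\Sigma).$$ Then a labelling of $\Sigma$ exists, and for every labelling and every $J\subseteq I$, $$\#\{w\in W:\operatorname{des}(w)=J\}=\#\{C' \text{ a chamber}:\operatorname{des}(C,C')=J\}=h_J(\Sigma).$$ -/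

import Mathlib

noncomputable section

namespace CoxeterComplex

variable {V : Type*} [NormedAddCommGroup V] [InnerProductSpace ℝ V]

/-- The linear hyperplane orthogonal to `α` (a hyperplane when `α ≠ 0`). -/
def hyperplane (α : V) : Submodule ℝ V := (Submodule.span ℝ {α})ᗮ

/-- `s` is the orthogonal reflection with respect to a hyperplane through the origin. -/
def IsReflection (s : V ≃ₗᵢ[ℝ] V) : Prop :=
  ∃ α : V, α ≠ 0 ∧ s = (Submodule.span ℝ {α})ᗮ.reflection

/-- A finite reflection group: a finite group of orthogonal transformations of `V` that is
generated by reflections with respect to hyperplanes through the origin. -/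
structure IsFiniteReflectionGroup (W : Subgroup (V ≃ₗᵢ[ℝ] V)) : Prop where
  finite : Finite W
  generated : ∃ S : Set (V ≃ₗᵢ[ℝ] V), (∀ s ∈ S, IsReflection s) ∧ Subgroup.closure S = W

/-- The normal vectors of the hyperplanes of the reflection arrangement of `W`, that is, of those
hyperplanes `H` with `s_H ∈ W`.  Every hyperplane of the arrangement occurs here through all its
nonzero normal vectors `α`, that is, through all the equations `⟪α, x⟫ = 0` defining it, so that no
positive side has to be chosen. -/
def normals (W : Subgroup (V ≃ₗᵢ[ℝ] V)) : Set V :=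
  {α | α ≠ 0 ∧ (Submodule.span ℝ {α})ᗮ.reflection ∈ W}

variable {W : Subgroup (V ≃ₗᵢ[ℝ] V)}

theorem map_mem_normals {w : V ≃ₗᵢ[ℝ] V} (hw : w ∈ W) {α : V} (hα : α ∈ normals W) :
    w α ∈ normals W := by
  refine ⟨fun h => hα.1 (by simpa using h), ?_⟩
  have h : (Submodule.span ℝ {w α})ᗮ.reflection
      = w * (Submodule.span ℝ {α})ᗮ.reflection * w⁻¹ := by
    ext x
    obtain ⟨y, rfl⟩ := w.surjective x
    have hy : w⁻¹ (w y) = y := w.symm_apply_apply y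
    change _ = w ((Submodule.span ℝ {α})ᗮ.reflection (w⁻¹ (w y)))
    rw [hy]
    simp [Submodule.reflection_orthogonal_apply, Submodule.reflection_singleton_apply]
  rw [h]
  exact W.mul_mem (W.mul_mem hw hα.2) (W.inv_mem hw)

variable (W) in
/-- A face of the reflection arrangement of `W`, given by its sign sequence; the sign sequences that
occur are those of the points of `V`.  The faces are the simplices of the Coxeter complex of `W`. -/
@[ext]
structure Face where
  sign : normals W → SignType
  realized : ∃ x : V, ∀ α, sign α = SignType.sign (inner ℝ (α : V) x)

namespace Face

/-- The face as a (nonempty, relatively open, convex) subset of `V`. -/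
def carrier (F : Face W) : Set V :=
  {x | ∀ α, F.sign α = SignType.sign (inner ℝ (α : V) x)}

/-- The face relation `F ≤ G`: every sign of `F` is zero or equal to the sign of `G`. -/
instance : PartialOrder (Face W) where
  le F G := ∀ α, F.sign α = 0 ∨ F.sign α = G.sign α
  le_refl _ _ := Or.inr rfl
  le_trans F G H h₁ h₂ α := by
    rcases h₁ α with h | h
    · exact Or.inl h
    · rw [h]; exact h₂ α
  le_antisymm F G h₁ h₂ := by
    ext α : 2
    rcases h₁ α with h | h
    · rcases h₂ α with h' | h'
      · rw [h, h']
      · exact h'.symm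
    · exact h

/-- The smallest face, which contains the origin; it is the empty simplex. -/
instance : OrderBot (Face W) where
  bot := ⟨fun _ => 0, 0, fun α => by simp⟩
  bot_le _ _ := Or.inl rfl

/-- The action of `W` on the faces. -/
instance : MulAction W (Face W) where
  smul w F :=
    { sign := fun α => F.sign ⟨(w⁻¹ : W).1 α, map_mem_normals (w⁻¹ : W).2 α.2⟩
      realized := by
        obtain ⟨x, hx⟩ := F.realized
        refine ⟨w.1 x, fun α => ?_⟩
        rw [hx]
        have h : w.1 ((w⁻¹ : W).1 (α : V)) = α := w.1.apply_symm_apply α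
        rw [← w.1.inner_map_map, h] }
  one_smul _ := rfl
  mul_smul w w' F := by
    ext α : 2
    change F.sign _ = F.sign _
    congr 2

/-- The action on faces is induced by the action of `W` on `V`. -/
theorem carrier_smul (w : W) (F : Face W) : (w • F).carrier = w.1 '' F.carrier := by
  ext y
  constructor
  · intro hy
    refine ⟨w.1.symm y, fun α => ?_, w.1.apply_symm_apply y⟩
    have h := hy ⟨w.1 α, map_mem_normals w.2 α.2⟩
    have e : (w • F).sign ⟨w.1 α, map_mem_normals w.2 α.2⟩ = F.sign α := by
      change F.sign _ = F.sign _
      congr 1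
      exact Subtype.ext (w.1.symm_apply_apply α)
    rw [← e, h, ← w.1.inner_map_map (α : V), w.1.apply_symm_apply]
  · rintro ⟨x, hx, rfl⟩ α
    have h : w.1 ((w⁻¹ : W).1 (α : V)) = α := w.1.apply_symm_apply α
    change F.sign _ = _
    rw [hx, ← w.1.inner_map_map, h]

/-- A chamber is a face that lies on no hyperplane of the arrangement. -/
def IsChamber (F : Face W) : Prop := ∀ α, F.sign α ≠ 0

theorem IsChamber.smul {F : Face W} (hF : F.IsChamber) (w : W) : (w • F).IsChamber :=
  fun _ => hF _

/-- The support: the intersection of the hyperplanes of the arrangement that contain the face. -/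
def supp (F : Face W) : Submodule ℝ V :=
  ⨅ (α : normals W) (_ : F.sign α = 0), hyperplane (α : V)

/-- The codimension of a face is that of its support. -/
def codim (F : Face W) : ℕ := Module.finrank ℝ (V ⧸ F.supp)

end Face

variable (W) in
/-- The vertices of the Coxeter complex: the minimal nonempty simplices. -/
def Vertex : Type _ := {v : Face W // IsAtom v}

/-- The set of vertices of a simplex. -/
def Face.vertices (F : Face W) : Set (Vertex W) := {v | v.1 ≤ F}

variable (W) in
/-- The chambers of the arrangement. -/
def Chamber : Type _ := {C : Face W // C.IsChamber}

instance : MulAction W (Chamber W) where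
  smul w C := ⟨w • C.1, C.2.smul w⟩
  one_smul C := Subtype.ext (one_smul W C.1)
  mul_smul w w' C := Subtype.ext (mul_smul w w' C.1)

/-- The rank of the Coxeter complex: the number of vertices of a chamber `C`. -/
def Chamber.rank (C : Chamber W) : ℕ := C.1.vertices.ncard

variable (W) in
/-- The graph of chambers: two distinct chambers are adjacent if they have a common face of
codimension one.  A gallery is a walk in this graph. -/
def chamberGraph : SimpleGraph (Chamber W) where
  Adj C D := C ≠ D ∧ ∃ F : Face W, F ≤ C.1 ∧ F ≤ D.1 ∧ F.codim = 1
  symm := ⟨fun _ _ ⟨h, F, h₁, h₂, h₃⟩ => ⟨h.symm, F, h₂, h₁, h₃⟩⟩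
  loopless := ⟨fun _ h => h.1 rfl⟩

variable {I : Type*}

/-- `τ` colors the vertices with `r` colors, where `r` is the number of vertices of the chamber `C`,
in such a way that distinct vertices that are joined by an edge (that is, that are vertices of a
common simplex) have distinct colors. -/
structure IsLabelling (C : Chamber W) (τ : Vertex W → I) : Prop where
  finite : Finite I
  card_eq : Nat.card I = C.rank
  ne_of_edge : ∀ v v' : Vertex W, v ≠ v' →
    (∃ F : Face W, v ∈ F.vertices ∧ v' ∈ F.vertices) → τ v ≠ τ v'

/-- The type of a simplex: the set of types of its vertices. -/
def Face.type (τ : Vertex W → I) (F : Face W) : Set I := τ '' F.vertices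

/-- Two distinct chambers are `i`-adjacent if they have a common face of codimension one whose type
is the complement of `i`. -/
def IAdjacent (τ : Vertex W → I) (i : I) (C D : Chamber W) : Prop :=
  C ≠ D ∧ ∃ F : Face W, F ≤ C.1 ∧ F ≤ D.1 ∧ F.codim = 1 ∧ F.type τ = {i}ᶜ

/-- The descent set of `C'` with respect to `C`: the set of `i` such that there is a minimal gallery
from `C` to `C'` whose last step, from `D` to `C'`, is an `i`-adjacency. -/
def descentSet (τ : Vertex W → I) (C C' : Chamber W) : Set I :=
  {i | ∃ (D : Chamber W) (p : (chamberGraph W).Walk C D) (h : (chamberGraph W).Adj D C'),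
    (p.concat h).length = (chamberGraph W).dist C C' ∧ IAdjacent τ i D C'}

/-- The number of elements `w` of `W` with descent set `J`, the chamber `wC` being the one that
corresponds to `w`. -/
def beta (τ : Vertex W → I) (C : Chamber W) (J : Finset I) : ℕ :=
  {w : W | descentSet τ C (w • C) = (J : Set I)}.ncard

/-- The number of chambers with descent set `J` with respect to `C`. -/
def betaChambers (τ : Vertex W → I) (C : Chamber W) (J : Finset I) : ℕ :=
  {C' : Chamber W | descentSet τ C C' = (J : Set I)}.ncard

/-- The `f`-vector: the number of simplices of type `J`. -/
def fVector (τ : Vertex W → I) (J : Finset I) : ℕ :=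
  {F : Face W | F.type τ = (J : Set I)}.ncard

/-- The `h`-vector: the alternating sum of `f_K` over all `K ⊆ J`, with sign `(-1) ^ |J - K|`. -/
def hVector [DecidableEq I] (τ : Vertex W → I) (J : Finset I) : ℤ :=
  ∑ K ∈ J.powerset, (-1) ^ (J \ K).card * (fVector τ K : ℤ)

end CoxeterComplex

end

noncomputable section

namespace CoxeterComplex

variable {V : Type*} [NormedAddCommGroup V] [InnerProductSpace ℝ V]
variable {W : Subgroup (V ≃ₗᵢ[ℝ] V)}

/-! ### Normal vectors -/

/-! By inclusion–exclusion it suffices that f_J counts the chambers D with des(C, D) ⊆ J. The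
bijection sends a simplex F of type J to the projection FC, the chamber having F as a face and lying
on the same side as C of every hyperplane through F (`Face.exists_product`). Its inverse sends D to
its unique face of type J. This rests on `descentSet_subset_type_iff`: for a face F of D, D = FC iff
des(C, D) ⊆ type(F).

The local geometry of a chamber D comes from a base: linearly independent unit normals whose
nonnegative combinations contain every normal positive on D (`Chamber.exists_isBase`). Faces of D
correspond to subsets of the base, so D is a simplex whose walls and vertices are indexed by the
base. Crossing a wall is a reflection that affects one hyperplane only, so gallery distance counts
separating hyperplanes, and i is a descent exactly when the wall of D opposite its vertex labelled i
separates D from C (`mem_descentSet_iff`).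

Elements of W correspond to chambers by simple transitivity: galleries give transitivity, an
exchange argument gives freeness. A labelling exists because each W-orbit of vertices meets C in
exactly one vertex; any labelling is bijective on the vertices of every chamber, which is all that
the counting needs. -/

instance : Neg (normals W) :=
  ⟨fun α => ⟨-(α : V), neg_ne_zero.2 α.2.1, by
    have h : Submodule.span ℝ {-(α : V)} = Submodule.span ℝ {(α : V)} := by
      rw [← Set.neg_singleton, Submodule.span_neg]
    simpa only [h] using α.2.2⟩⟩

@[simp]
theorem normals_coe_neg (α : normals W) : ((-α : normals W) : V) = -(α : V) := rfl

instance : MulAction W (normals W) where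
  smul w α := ⟨w.1 α, map_mem_normals w.2 α.2⟩
  one_smul _ := rfl
  mul_smul _ _ _ := rfl

@[simp]
theorem normals_coe_smul (w : W) (α : normals W) : ((w • α : normals W) : V) = w.1 α := rfl

theorem normals_smul_neg (w : W) (α : normals W) : w • (-α) = -(w • α) :=
  Subtype.ext (map_neg w.1 (α : V))

/-- The reflection of `W` with respect to the hyperplane orthogonal to a normal vector. -/
def reflectionIn (α : normals W) : W := ⟨_, α.2.2⟩

theorem reflectionIn_apply (α : normals W) (x : V) :
    (reflectionIn α).1 x = x - (2 * inner ℝ (α : V) x / ‖(α : V)‖ ^ 2) • (α : V) := by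
  change (Submodule.span ℝ {(α : V)})ᗮ.reflection x = _
  rw [Submodule.reflection_orthogonal_apply, Submodule.reflection_singleton_apply, neg_sub,
    ← Nat.cast_smul_eq_nsmul ℝ, smul_smul]
  simp only [mul_div_assoc, Nat.cast_ofNat, RCLike.ofReal_real_eq_id, id]

theorem reflectionIn_apply_of_norm {α : normals W} (h : ‖(α : V)‖ = 1) (x : V) :
    (reflectionIn α).1 x = x - (2 * inner ℝ (α : V) x) • (α : V) := by
  rw [(reflectionIn_apply α), h, one_pow, div_one]

theorem reflectionIn_smul_self (α : normals W) : (reflectionIn α) • α = -α := by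
  refine Subtype.ext ?_
  have h : ‖(α : V)‖ ^ 2 ≠ 0 := pow_ne_zero _ (norm_ne_zero_iff.2 α.2.1)
  change (reflectionIn α).1 (α : V) = -(α : V)
  rw [(reflectionIn_apply α), real_inner_self_eq_norm_sq, mul_div_assoc, div_self h, mul_one, two_smul]
  abel

theorem reflectionIn_mul_self (α : normals W) : reflectionIn α * (reflectionIn α) = 1 :=
  Subtype.ext (Submodule.reflection_mul_reflection _)

theorem reflectionIn_inv (α : normals W) : (reflectionIn α)⁻¹ = reflectionIn α :=
  inv_eq_of_mul_eq_one_left (reflectionIn_mul_self α)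

theorem reflectionIn_smul (w : W) (α : normals W) : reflectionIn (w • α) = w * (reflectionIn α) * w⁻¹ := by
  refine Subtype.ext (LinearIsometryEquiv.ext fun x => ?_)
  obtain ⟨y, rfl⟩ := w.1.surjective x
  have hy : (w⁻¹ : W).1 (w.1 y) = y := w.1.symm_apply_apply y
  change (reflectionIn (w • α)).1 (w.1 y) = w.1 ((reflectionIn α).1 ((w⁻¹ : W).1 (w.1 y)))
  rw [hy, reflectionIn_apply, reflectionIn_apply, normals_coe_smul, w.1.inner_map_map,
    w.1.norm_map, map_sub, map_smul]

theorem reflectionIn_eq_of_coe_eq_smul {α β : normals W} {c : ℝ} (h : (α : V) = c • (β : V)) :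
    (reflectionIn α) = reflectionIn β := by
  have hc : c ≠ 0 := by
    rintro rfl
    exact α.2.1 (by simpa using h)
  refine Subtype.ext ?_
  change (Submodule.span ℝ {(α : V)})ᗮ.reflection = (Submodule.span ℝ {(β : V)})ᗮ.reflection
  have : Submodule.span ℝ {(α : V)} = Submodule.span ℝ {(β : V)} := by
    rw [h, Submodule.span_singleton_smul_eq (IsUnit.mk0 c hc)]
  simp only [this]

variable (W) in
/-- The unit normal vectors of the arrangement. -/
def unitNormals : Set (normals W) := {α | ‖(α : V)‖ = 1}

theorem unitNormals.neg_mem {α : normals W} (h : α ∈ unitNormals W) : -α ∈ unitNormals W := by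
  simpa [unitNormals] using h

theorem unitNormals.smul_mem (w : W) {α : normals W} (h : α ∈ unitNormals W) :
    w • α ∈ unitNormals W := by
  simpa [unitNormals] using h

theorem exists_unit (α : normals W) :
    ∃ β ∈ unitNormals W, ∃ c : ℝ, 0 < c ∧ (α : V) = c • (β : V) := by
  have h0 : 0 < ‖(α : V)‖ := norm_pos_iff.2 α.2.1
  have hs : Submodule.span ℝ {‖(α : V)‖⁻¹ • (α : V)} = Submodule.span ℝ {(α : V)} :=
    Submodule.span_singleton_smul_eq (IsUnit.mk0 _ (inv_ne_zero h0.ne')) _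
  refine ⟨⟨‖(α : V)‖⁻¹ • (α : V), smul_ne_zero (inv_ne_zero h0.ne') α.2.1, ?_⟩, ?_,
    ‖(α : V)‖, h0, ?_⟩
  · simpa only [hs] using α.2.2
  · change ‖‖(α : V)‖⁻¹ • (α : V)‖ = 1
    rw [norm_smul, norm_inv, norm_norm, inv_mul_cancel₀ h0.ne']
  · rw [smul_smul, mul_inv_cancel₀ h0.ne', one_smul]

theorem eq_or_eq_neg_of_mem_unitNormals {α β : normals W} (hα : α ∈ unitNormals W)
    (hβ : β ∈ unitNormals W) {c : ℝ} (h : (α : V) = c • (β : V)) : α = β ∨ α = -β := by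
  have h' : |c| = 1 := by
    have := congrArg norm h
    rw [norm_smul, hα, hβ, mul_one, Real.norm_eq_abs] at this
    exact this.symm
  rcases eq_or_eq_neg_of_abs_eq h' with rfl | rfl
  · exact Or.inl (Subtype.ext (by simpa using h))
  · exact Or.inr (Subtype.ext (by simpa using h))

theorem eq_or_eq_neg_of_reflectionIn_eq {α β : normals W} (hα : α ∈ unitNormals W)
    (hβ : β ∈ unitNormals W) (h : reflectionIn α = reflectionIn β) : α = β ∨ α = -β := by
  refine eq_or_eq_neg_of_mem_unitNormals (c := inner ℝ (β : V) α) hα hβ ?_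
  have h1 : (reflectionIn α).1 (α : V) = -(α : V) := congrArg Subtype.val (reflectionIn_smul_self α)
  rw [h, reflectionIn_apply_of_norm hβ] at h1
  have h2 : (2 : ℝ) • (α : V) = (2 : ℝ) • inner ℝ (β : V) (α : V) • (β : V) := by
    rw [smul_smul, two_smul]
    rw [← sub_eq_zero]
    rw [← sub_eq_zero] at h1
    rw [← h1]
    abel
  exact smul_right_injective V (two_ne_zero (α := ℝ)) h2

-- A unit normal is determined up to sign by its reflection, and W is finite. The set `normals W` is
-- closed under nonzero scaling, so finiteness arguments have to go through unit normals.
variable (W) in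
theorem finite_unitNormals [Finite W] : (unitNormals W).Finite := by
  refine Set.Finite.of_finite_fibers reflectionIn (Set.toFinite _) ?_
  rintro _ ⟨α, hα, rfl⟩
  refine (Set.toFinite {α, -α}).subset ?_
  rintro β ⟨hβ, h⟩
  exact eq_or_eq_neg_of_reflectionIn_eq hβ hα h

/-! ### Signs -/

namespace Face

theorem sign_neg (F : Face W) (α : normals W) : F.sign (-α) = -F.sign α := by
  obtain ⟨x, hx⟩ := F.realized
  rw [hx, hx, normals_coe_neg, inner_neg_left, Left.sign_neg]

theorem sign_eq_of_pos_smul (F : Face W) {α β : normals W} {c : ℝ} (hc : 0 < c)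
    (h : (α : V) = c • (β : V)) : F.sign α = F.sign β := by
  obtain ⟨x, hx⟩ := F.realized
  rw [hx, hx, h, real_inner_smul_left, sign_mul, sign_pos hc, one_mul]

theorem sign_smul (w : W) (F : Face W) (α : normals W) :
    (w • F).sign α = F.sign (w⁻¹ • α) := rfl

theorem sign_smul_smul (w : W) (F : Face W) (α : normals W) :
    (w • F).sign (w • α) = F.sign α := by
  rw [sign_smul, inv_smul_smul]

/-- The signs at α and -α are opposite, so knowing where the value 1 occurs also tells where -1, and
hence 0, occurs. -/
theorem ext_of_sign_one {F G : Face W} (h : ∀ α, F.sign α = 1 ↔ G.sign α = 1) : F = G := by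
  ext α : 2
  have h1 := h α
  have h2 := h (-α)
  rw [F.sign_neg, G.sign_neg] at h2
  revert h1 h2
  generalize F.sign α = a
  generalize G.sign α = b
  revert a b
  decide

/-- The faces are determined by their signs on the unit normals. -/
theorem ext_of_unit {F G : Face W} (h : ∀ α ∈ unitNormals W, F.sign α = G.sign α) : F = G := by
  ext α : 2
  obtain ⟨β, hβ, c, hc, e⟩ := exists_unit α
  rw [F.sign_eq_of_pos_smul hc e, G.sign_eq_of_pos_smul hc e, h β hβ]

theorem smul_le_smul (w : W) {F G : Face W} (h : F ≤ G) : w • F ≤ w • G :=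
  fun α => h (w⁻¹ • α)

theorem smul_le_smul_iff (w : W) {F G : Face W} : w • F ≤ w • G ↔ F ≤ G :=
  ⟨fun h => by simpa using smul_le_smul w⁻¹ h, smul_le_smul w⟩

theorem sign_eq_of_le {F G : Face W} (h : F ≤ G) {α : normals W} (hα : F.sign α ≠ 0) :
    G.sign α = F.sign α :=
  ((h α).resolve_left hα).symm

instance [Finite W] : Finite (Face W) := by
  have := (finite_unitNormals W).to_subtype
  refine Finite.of_injective (fun (F : Face W) (α : unitNormals W) => F.sign α) fun F G h => ?_
  exact ext_of_unit fun α hα => congrFun h ⟨α, hα⟩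

end Face

theorem Chamber.sign_ne_one (D : Chamber W) {α : normals W} :
    D.1.sign α ≠ 1 ↔ D.1.sign α = -1 := by
  have h := D.2 α
  revert h
  generalize D.1.sign α = a
  revert a
  decide

theorem Chamber.sign_eq_one_or (D : Chamber W) (α : normals W) :
    D.1.sign α = 1 ∨ D.1.sign (-α) = 1 := by
  by_cases h : D.1.sign α = 1
  · exact Or.inl h
  · rw [D.1.sign_neg, D.sign_ne_one.1 h]
    exact Or.inr (by decide)

theorem Chamber.le_iff_eq {C D : Chamber W} : C.1 ≤ D.1 ↔ C = D :=
  ⟨fun h => Subtype.ext (by ext α : 2; exact (Face.sign_eq_of_le h (C.2 α)).symm), fun h => h ▸ le_rfl⟩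

@[simp]
theorem Chamber.coe_smul (w : W) (D : Chamber W) : (w • D).1 = w • D.1 := rfl

instance [Finite W] : Finite (Chamber W) := Subtype.finite
instance [Finite W] : Finite (Vertex W) := Subtype.finite

/-! ### Simple systems -/

/-- `B` is the system of simple unit normals of the face `D` (which will be a chamber). -/
structure IsBase (D : Face W) (B : Finset (normals W)) : Prop where
  norm_eq : ∀ δ ∈ B, δ ∈ unitNormals W
  pos : ∀ δ ∈ B, D.sign δ = 1
  linearIndep : LinearIndepOn ℝ (fun α : normals W => (α : V)) B
  exists_coeff : ∀ α, D.sign α = 1 →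
    ∃ c : normals W → ℝ, (∀ δ, 0 ≤ c δ) ∧ (α : V) = ∑ δ ∈ B, c δ • (δ : V)

/-- `B` consists of unit normals positive on `D` whose cone contains all of them. -/
structure Generates (D : Face W) (B : Finset (normals W)) : Prop where
  norm_eq : ∀ δ ∈ B, δ ∈ unitNormals W
  pos : ∀ δ ∈ B, D.sign δ = 1
  exists_coeff : ∀ α, D.sign α = 1 →
    ∃ c : normals W → ℝ, (∀ δ, 0 ≤ c δ) ∧ (α : V) = ∑ δ ∈ B, c δ • (δ : V)

open Classical in
theorem Generates.erase {D : Face W} {B : Finset (normals W)} (hB : Generates D B)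
    {δ : normals W} (hδ : δ ∈ B) {c : normals W → ℝ} (hc : ∀ γ, 0 ≤ c γ)
    (h : (δ : V) = ∑ γ ∈ B.erase δ, c γ • (γ : V)) : Generates D (B.erase δ) where
  norm_eq γ hγ := hB.norm_eq γ (Finset.mem_of_mem_erase hγ)
  pos γ hγ := hB.pos γ (Finset.mem_of_mem_erase hγ)
  exists_coeff α hα := by
    obtain ⟨a, ha, e⟩ := hB.exists_coeff α hα
    refine ⟨fun γ => a δ * c γ + a γ, fun γ => add_nonneg (mul_nonneg (ha _) (hc _)) (ha _), ?_⟩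
    rw [e, ← Finset.add_sum_erase B _ hδ]
    nth_rewrite 1 [h]
    rw [Finset.smul_sum, ← Finset.sum_add_distrib]
    exact Finset.sum_congr rfl fun γ _ => by rw [smul_smul, add_smul]

-- In a minimal generating set no element lies in the cone of the others. If the coefficient of β is
-- below 1, solving for β would put it there; otherwise pairing with a point of D makes a sum of
-- nonnegative terms nonpositive, so every term vanishes.
open Classical in
theorem Generates.coeff_eq_zero {D : Face W} {B : Finset (normals W)} (hB : Generates D B)
    (hmin : ∀ δ ∈ B, ¬ Generates D (B.erase δ)) {β : normals W} (hβ : β ∈ B)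
    {d : normals W → ℝ} (hd : ∀ γ, 0 ≤ d γ) (h : (β : V) = ∑ γ ∈ B, d γ • (γ : V))
    {γ : normals W} (hγ : γ ∈ B) (hne : γ ≠ β) : d γ = 0 := by
  have h1 : (1 - d β) • (β : V) = ∑ γ ∈ B.erase β, d γ • (γ : V) := by
    rw [sub_smul, one_smul, sub_eq_iff_eq_add, add_comm, Finset.add_sum_erase B (fun γ => d γ • (γ : V)) hβ]
    exact h
  rcases lt_or_ge (d β) 1 with hlt | hge
  · refine absurd (hB.erase hβ (c := fun γ => (1 - d β)⁻¹ * d γ) (fun γ => ?_) ?_) (hmin β hβ)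
    · exact mul_nonneg (inv_nonneg.2 (sub_nonneg.2 hlt.le)) (hd γ)
    · simp_rw [← smul_smul]
      rw [← Finset.smul_sum, ← h1, smul_smul, inv_mul_cancel₀ (sub_pos.2 hlt).ne', one_smul]
  · obtain ⟨x, hx⟩ := D.realized
    have hpos : ∀ γ ∈ B, 0 < inner ℝ (γ : V) x := fun γ hγ => by
      have := hB.pos γ hγ
      rwa [hx, sign_eq_one_iff] at this
    have h2 := congrArg (fun v => inner ℝ v x) h1
    simp only [sum_inner, real_inner_smul_left] at h2
    have h3 : ∀ ε ∈ B.erase β, 0 ≤ d ε * inner ℝ (ε : V) x := fun ε hε =>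
      mul_nonneg (hd ε) (hpos ε (Finset.mem_of_mem_erase hε)).le
    have h4 : ∑ ε ∈ B.erase β, d ε * inner ℝ (ε : V) x = 0 :=
      le_antisymm (h2 ▸ mul_nonpos_of_nonpos_of_nonneg (by linarith) (hpos β hβ).le)
        (Finset.sum_nonneg h3)
    have h5 := (Finset.sum_eq_zero_iff_of_nonneg h3).1 h4 γ (Finset.mem_erase.2 ⟨hne, hγ⟩)
    exact (mul_eq_zero.1 h5).resolve_right (hpos γ hγ).ne'

-- If the inner product were positive, the normal β - kα, or its negative, would be a nonnegative
-- combination of B. Solving for β or for α contradicts `Generates.coeff_eq_zero`.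
open Classical in
theorem Generates.inner_nonpos {D : Chamber W} {B : Finset (normals W)} (hB : Generates D.1 B)
    (hmin : ∀ δ ∈ B, ¬ Generates D.1 (B.erase δ)) {α β : normals W} (hα : α ∈ B) (hβ : β ∈ B)
    (hne : α ≠ β) : inner ℝ (α : V) (β : V) ≤ 0 := by
  by_contra! hk
  -- Since α is a unit vector, its reflection sends β to β - kα.
  set k : ℝ := 2 * inner ℝ (α : V) (β : V) with hk'
  have hk0 : 0 < k := by positivity
  have hγ : (((reflectionIn α) • β : normals W) : V) = (β : V) - k • (α : V) :=
    reflectionIn_apply_of_norm (hB.norm_eq α hα) _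
  have hsum : ∀ (c : normals W → ℝ) (ε : normals W), ε ∈ B → ∀ r : ℝ,
      ∑ γ ∈ B, (c γ + if γ = ε then r else 0) • (γ : V) = ∑ γ ∈ B, c γ • (γ : V) + r • (ε : V) := by
    intro c ε hε r
    simp [add_smul, Finset.sum_add_distrib, hε]
  have hnn : ∀ (c : normals W → ℝ) (ε : normals W) (r : ℝ), (∀ δ, 0 ≤ c δ) → 0 ≤ r →
      ∀ γ, 0 ≤ c γ + if γ = ε then r else 0 := by
    intro c ε r hc hr γ
    refine add_nonneg (hc γ) ?_
    split_ifs <;> simp [hr]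
  rcases D.sign_eq_one_or ((reflectionIn α) • β) with h | h
  · obtain ⟨c, hc, e⟩ := hB.exists_coeff _ h
    have := hB.coeff_eq_zero hmin hβ (hnn c α k hc hk0.le)
      (by rw [hsum c α hα k, ← e, hγ]; abel) hα hne
    rw [if_pos rfl] at this
    linarith [hc α]
  · obtain ⟨c, hc, e⟩ := hB.exists_coeff _ h
    -- Here kα - β is the combination with coefficients c, so α = k⁻¹(β + that combination), where β
    -- has coefficient at least k⁻¹ > 0.
    have := hB.coeff_eq_zero hmin hα
      (hnn (fun γ => k⁻¹ * c γ) β k⁻¹ (fun δ => mul_nonneg (inv_nonneg.2 hk0.le) (hc δ))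
        (inv_nonneg.2 hk0.le))
      (by
        rw [hsum _ β hβ]
        simp_rw [← smul_smul]
        rw [← Finset.smul_sum, ← e, normals_coe_neg, hγ, ← smul_add, neg_sub, sub_add_cancel,
          smul_smul, inv_mul_cancel₀ hk0.ne', one_smul]) hβ hne.symm
    rw [if_pos rfl] at this
    have h1 : 0 < k⁻¹ := inv_pos.2 hk0
    have h2 := mul_nonneg h1.le (hc β)
    linarith

/-- All positive unit normals generate; take a generating subset of least cardinality. Its elements
are pairwise at non-acute angles and lie in an open half-space, hence are linearly independent. -/
theorem Chamber.exists_isBase [Finite W] (D : Chamber W) : ∃ B, IsBase D.1 B := by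
  classical
  set P : Finset (normals W) := (finite_unitNormals W).toFinset.filter (fun α => D.1.sign α = 1)
  have hP : Generates D.1 P := by
    refine ⟨fun δ hδ => ?_, fun δ hδ => (Finset.mem_filter.1 hδ).2, fun α hα => ?_⟩
    · simpa using (Finset.mem_filter.1 hδ).1
    · obtain ⟨β, hβ, c, hc, e⟩ := exists_unit α
      rw [D.1.sign_eq_of_pos_smul hc e] at hα
      have hβP : β ∈ P := Finset.mem_filter.2 ⟨by simpa using hβ, hα⟩
      refine ⟨fun γ => if γ = β then c else 0, fun γ => ?_, ?_⟩
      · dsimp only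
        split_ifs <;> simp [hc.le]
      · simp [hβP, e]
  obtain ⟨B, hB, hmin⟩ := Finset.exists_min_image (P.powerset.filter (Generates D.1)) Finset.card
    ⟨P, by simp [hP]⟩
  obtain ⟨hBP, hB⟩ := Finset.mem_filter.1 hB
  have hmin' : ∀ δ ∈ B, ¬ Generates D.1 (B.erase δ) := fun δ hδ h => by
    have := hmin (B.erase δ) (Finset.mem_filter.2 ⟨Finset.mem_powerset.2
      ((Finset.erase_subset _ _).trans (Finset.mem_powerset.1 hBP)), h⟩)
    exact absurd this (not_le.2 (Finset.card_erase_lt_of_mem hδ))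
  refine ⟨B, hB.norm_eq, hB.pos, ?_, hB.exists_coeff⟩
  obtain ⟨x, hx⟩ := D.1.realized
  refine LinearMap.BilinForm.linearIndependent_of_pairwise_le_zero (innerₗ V) ?_ (innerₗ V x) _
    (fun δ => ?_) (fun α β hne => ?_)
  · intro y hy
    have := norm_pos_iff.2 hy
    simpa [real_inner_self_eq_norm_sq] using pow_pos this 2
  · have := hB.pos δ.1 δ.2
    rw [hx, sign_eq_one_iff] at this
    simpa [real_inner_comm] using this
  · exact hB.inner_nonpos hmin' α.2 β.2 (fun h => hne (Subtype.ext h))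

/-! ### The faces of a chamber -/

namespace Face

theorem sign_ne_neg_one_of_le {F G : Face W} (h : F ≤ G) {α : normals W} (hα : G.sign α = 1) :
    F.sign α ≠ -1 := by
  rcases h α with h | h
  · rw [h]; decide
  · rw [h, hα]; decide

theorem sign_eq_one_of_le {F G : Face W} (h : F ≤ G) {α : normals W} (hα : G.sign α = 1)
    (h0 : F.sign α ≠ 0) : F.sign α = 1 := by
  rw [← hα, sign_eq_of_le h h0]

/-- Pairing with a point of F gives a sum of nonnegative terms, one of them positive. Only the terms
that really occur need a sign condition. -/
theorem sign_sum_eq_one {F : Face W} {B : Finset (normals W)} {α : normals W} {c : normals W → ℝ}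
    (hc : ∀ δ, 0 ≤ c δ) (hα : (α : V) = ∑ δ ∈ B, c δ • (δ : V))
    (hF : ∀ δ ∈ B, c δ ≠ 0 → F.sign δ ≠ -1) {δ : normals W} (hδ : δ ∈ B) (hcδ : c δ ≠ 0)
    (h : F.sign δ ≠ 0) : F.sign α = 1 := by
  obtain ⟨x, hx⟩ := F.realized
  have hnn : ∀ γ ∈ B, 0 ≤ c γ * inner ℝ (γ : V) x := by
    intro γ hγ
    by_cases h0 : c γ = 0
    · simp [h0]
    · refine mul_nonneg (hc γ) ?_
      have := hF γ hγ h0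
      rw [hx] at this
      exact not_lt.1 fun h => this (_root_.sign_neg h)
  have hpos : 0 < c δ * inner ℝ (δ : V) x := by
    refine (hnn δ hδ).lt_of_ne' (mul_ne_zero hcδ fun h0 => h ?_)
    rw [hx, h0, sign_zero]
  rw [hx, sign_eq_one_iff, hα, sum_inner]
  simp only [real_inner_smul_left]
  exact Finset.sum_pos' hnn ⟨δ, hδ, hpos⟩

theorem sign_sum_eq_zero {F : Face W} {B : Finset (normals W)} {α : normals W} {c : normals W → ℝ}
    (hα : (α : V) = ∑ δ ∈ B, c δ • (δ : V)) (h : ∀ δ ∈ B, c δ ≠ 0 → F.sign δ = 0) :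
    F.sign α = 0 := by
  obtain ⟨x, hx⟩ := F.realized
  rw [hx, sign_eq_zero_iff, hα, sum_inner]
  refine Finset.sum_eq_zero fun δ hδ => ?_
  by_cases h0 : c δ = 0
  · simp [h0]
  · have := h δ hδ h0
    rw [hx, sign_eq_zero_iff] at this
    rw [real_inner_smul_left, this, mul_zero]

end Face

theorem exists_coeff_ne_zero {B : Finset (normals W)} {α : normals W} {c : normals W → ℝ}
    (hα : (α : V) = ∑ δ ∈ B, c δ • (δ : V)) : ∃ δ ∈ B, c δ ≠ 0 := by
  by_contra! h
  refine α.2.1 (hα.trans (Finset.sum_eq_zero fun δ hδ => ?_))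
  rw [h δ hδ, zero_smul]

namespace IsBase

variable {D : Chamber W} {B : Finset (normals W)}

theorem sign_ne_neg_one (hB : IsBase D.1 B) {F : Face W} (hF : F ≤ D.1) {δ : normals W}
    (hδ : δ ∈ B) : F.sign δ ≠ -1 :=
  Face.sign_ne_neg_one_of_le hF (hB.pos δ hδ)

theorem eq_of_sign_eq_one (hB : IsBase D.1 B) {C : Chamber W} (h : ∀ δ ∈ B, C.1.sign δ = 1) :
    C = D := by
  have key : ∀ α, D.1.sign α = 1 → C.1.sign α = 1 := by
    intro α hα
    obtain ⟨c, hc, e⟩ := hB.exists_coeff α hα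
    obtain ⟨δ, hδ, h0⟩ := exists_coeff_ne_zero e
    exact Face.sign_sum_eq_one hc e (fun γ hγ _ => by rw [h γ hγ]; decide) hδ h0 (C.2 δ)
  refine Subtype.ext (Face.ext_of_sign_one fun α => ⟨fun h1 => ?_, key α⟩)
  rcases D.sign_eq_one_or α with h2 | h2
  · exact h2
  · have := key _ h2
    rw [C.1.sign_neg, h1] at this
    exact absurd this (by decide)

/-- A normal positive on D is nonzero on a face of D iff some simple normal in its expansion is, so
the simple normals vanishing on a face determine all its signs. -/
theorem le_iff (hB : IsBase D.1 B) {F G : Face W} (hF : F ≤ D.1) (hG : G ≤ D.1) :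
    F ≤ G ↔ ∀ δ ∈ B, G.sign δ = 0 → F.sign δ = 0 := by
  refine ⟨fun h δ _ h0 => (h δ).elim id fun h' => h'.trans h0, fun h => ?_⟩
  have key : ∀ α, D.1.sign α = 1 → F.sign α = 0 ∨ F.sign α = G.sign α := by
    intro α hα
    by_cases h0 : F.sign α = 0
    · exact Or.inl h0
    right
    obtain ⟨c, hc, e⟩ := hB.exists_coeff α hα
    have : ∃ δ ∈ B, c δ ≠ 0 ∧ F.sign δ ≠ 0 := by
      by_contra! h1
      exact h0 (Face.sign_sum_eq_zero e h1)
    obtain ⟨δ, hδ, hcδ, hFδ⟩ := this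
    rw [Face.sign_eq_one_of_le hF hα h0, Face.sign_sum_eq_one hc e
      (fun γ hγ _ => hB.sign_ne_neg_one hG hγ) hδ hcδ fun hg => hFδ (h δ hδ hg)]
  intro α
  rcases D.sign_eq_one_or α with h1 | h1
  · exact key α h1
  · have := key _ h1
    rw [F.sign_neg, G.sign_neg] at this
    revert this
    generalize F.sign α = a
    generalize G.sign α = b
    revert a b
    decide

theorem ext_face (hB : IsBase D.1 B) {F G : Face W} (hF : F ≤ D.1) (hG : G ≤ D.1)
    (h : ∀ δ ∈ B, F.sign δ = 0 ↔ G.sign δ = 0) : F = G :=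
  le_antisymm ((hB.le_iff hF hG).2 fun δ hδ => (h δ hδ).2)
    ((hB.le_iff hG hF).2 fun δ hδ => (h δ hδ).1)

variable [FiniteDimensional ℝ V]

/-- By linear independence some linear functional is 0 on the simple normals in K and 1 on the
others; the point of V representing it lies in the desired face. -/
theorem exists_face (hB : IsBase D.1 B) (K : Set (normals W)) :
    ∃ F : Face W, F ≤ D.1 ∧ ∀ δ ∈ B, F.sign δ = 0 ↔ δ ∈ K := by
  classical
  obtain ⟨f, hf⟩ : ∃ f : V →ₗ[ℝ] ℝ, ∀ δ ∈ B, f (δ : V) = if δ ∈ K then 0 else 1 := by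
    have hli : LinearIndependent ℝ (fun δ : B => ((δ : normals W) : V)) := hB.linearIndep
    obtain ⟨f, hf⟩ := LinearMap.exists_extend
      ((Module.Basis.span hli).constr ℝ fun δ : B => if δ.1 ∈ K then (0 : ℝ) else 1)
    refine ⟨f, fun δ hδ => ?_⟩
    have h1 := congrArg (fun g => g (Module.Basis.span hli ⟨δ, hδ⟩)) hf
    simp only [LinearMap.comp_apply, Module.Basis.constr_basis, Submodule.subtype_apply] at h1
    rw [Module.Basis.span_apply] at h1
    exact h1
  set x : V := (InnerProductSpace.toDual ℝ V).symm (LinearMap.toContinuousLinearMap f)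
  have hx : ∀ v, inner ℝ v x = f v := fun v => by
    rw [real_inner_comm, InnerProductSpace.toDual_symm_apply]
    rfl
  let F : Face W := ⟨fun α => SignType.sign (inner ℝ (α : V) x), x, fun _ => rfl⟩
  have hFs : ∀ δ ∈ B, F.sign δ = if δ ∈ K then 0 else 1 := fun δ hδ => by
    change SignType.sign (inner ℝ (δ : V) x) = _
    rw [hx, hf δ hδ]
    split_ifs <;> simp
  have hFn : ∀ δ ∈ B, F.sign δ ≠ -1 := fun δ hδ => by
    rw [hFs δ hδ]
    split_ifs <;> decide
  have key : ∀ α, D.1.sign α = 1 → F.sign α = 0 ∨ F.sign α = 1 := by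
    intro α hα
    obtain ⟨c, hc, e⟩ := hB.exists_coeff α hα
    by_cases h : ∀ δ ∈ B, c δ ≠ 0 → F.sign δ = 0
    · exact Or.inl (Face.sign_sum_eq_zero e h)
    · push Not at h
      obtain ⟨δ, hδ, hcδ, hFδ⟩ := h
      exact Or.inr (Face.sign_sum_eq_one hc e (fun γ hγ _ => hFn γ hγ) hδ hcδ hFδ)
  refine ⟨F, fun α => ?_, fun δ hδ => ?_⟩
  · rcases D.sign_eq_one_or α with h1 | h1
    · rw [h1]; exact key α h1
    · have h2 := key _ h1
      rw [D.1.sign_neg] at h1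
      rw [F.sign_neg] at h2
      revert h1 h2
      generalize F.sign α = a
      generalize D.1.sign α = b
      revert a b
      decide
  · rw [hFs δ hδ]
    split_ifs with h <;> simp [h]

/-- Every normal vanishing on F lies in the span of the simple normals vanishing on F, so the
support is the orthogonal complement of that span. -/
theorem codim_eq (hB : IsBase D.1 B) {F : Face W} (hF : F ≤ D.1) :
    F.codim = (B.filter fun δ => F.sign δ = 0).card := by
  set Z := B.filter fun δ => F.sign δ = 0 with hZ
  have hli : LinearIndependent ℝ (fun δ : Z => ((δ : normals W) : V)) :=
    hB.linearIndep.mono (Finset.coe_subset.2 (Finset.filter_subset _ _))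
  set K := Submodule.span ℝ (Set.range fun δ : Z => ((δ : normals W) : V)) with hK
  have hmemK : ∀ α : normals W, D.1.sign α = 1 → F.sign α = 0 → (α : V) ∈ K := by
    intro α h1 h0
    obtain ⟨c, hc, e⟩ := hB.exists_coeff α h1
    rw [e]
    refine Submodule.sum_mem _ fun δ hδ => ?_
    by_cases hcδ : c δ = 0
    · rw [hcδ, zero_smul]; exact K.zero_mem
    · refine K.smul_mem _ (Submodule.subset_span ⟨⟨δ, Finset.mem_filter.2 ⟨hδ, ?_⟩⟩, rfl⟩)
      by_contra h
      rw [Face.sign_sum_eq_one hc e (fun γ hγ _ => hB.sign_ne_neg_one hF hγ) hδ hcδ h] at h0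
      exact absurd h0 (by decide)
  have hmemK' : ∀ α : normals W, F.sign α = 0 → (α : V) ∈ K := by
    intro α h0
    rcases D.sign_eq_one_or α with h1 | h1
    · exact hmemK α h1 h0
    · have := hmemK _ h1 (by rw [F.sign_neg, h0]; decide)
      rw [normals_coe_neg] at this
      simpa using K.neg_mem this
  have hsupp : F.supp = Kᗮ := by
    refine le_antisymm ?_ ?_
    · rw [Submodule.le_orthogonal_iff_le_orthogonal, hK, Submodule.span_le]
      rintro _ ⟨⟨δ, hδ⟩, rfl⟩
      intro y hy
      have h1 : y ∈ hyperplane (δ : V) := by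
        rw [Face.supp, Submodule.mem_iInf] at hy
        exact (Submodule.mem_iInf _).1 (hy δ) (Finset.mem_filter.1 hδ).2
      rw [real_inner_comm]
      exact h1 _ (Submodule.mem_span_singleton_self _)
    · rw [Face.supp]
      refine le_iInf₂ fun α hα => Submodule.orthogonal_le ?_
      rw [Submodule.span_singleton_le_iff_mem]
      exact hmemK' α hα
  have h1 := Submodule.finrank_quotient_add_finrank (F.supp)
  have h2 := Submodule.finrank_add_finrank_orthogonal K
  have h3 : Module.finrank ℝ K = Z.card := by
    rw [finrank_span_eq_card hli, Fintype.card_coe]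
  rw [← hsupp] at h2
  rw [Face.codim, ← h3]
  omega

theorem codim_eq_one_iff (hB : IsBase D.1 B) {F : Face W} (hF : F ≤ D.1) :
    F.codim = 1 ↔ ∃ δ ∈ B, ∀ γ ∈ B, F.sign γ = 0 ↔ γ = δ := by
  rw [hB.codim_eq hF, Finset.card_eq_one]
  constructor
  · rintro ⟨δ, h⟩
    have h' := fun γ => Finset.ext_iff.1 h γ
    simp only [Finset.mem_filter, Finset.mem_singleton] at h'
    exact ⟨δ, ((h' δ).2 rfl).1, fun γ hγ => ⟨fun h0 => (h' γ).1 ⟨hγ, h0⟩, fun h0 => ((h' γ).2 h0).2⟩⟩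
  · rintro ⟨δ, hδ, h⟩
    refine ⟨δ, Finset.ext fun γ => ?_⟩
    simp only [Finset.mem_filter, Finset.mem_singleton]
    exact ⟨fun h0 => (h γ h0.1).1 h0.2, fun h0 => h0 ▸ ⟨hδ, (h δ hδ).2 rfl⟩⟩

/-! ### Vertices of a chamber, indexed by its simple normals. -/

theorem exists_vertex (hB : IsBase D.1 B) (δ : B) :
    ∃ v : Vertex W, v.1 ≤ D.1 ∧ ∀ γ ∈ B, v.1.sign γ = 0 ↔ γ ≠ δ := by
  obtain ⟨F, hF, hz⟩ := hB.exists_face {γ | γ ≠ δ}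
  refine ⟨⟨F, ?_, fun G hG => ?_⟩, hF, hz⟩
  · rintro rfl
    exact (hz δ δ.2).1 rfl rfl
  · have hGD : G ≤ D.1 := hG.le.trans hF
    refine le_bot_iff.1 ((hB.le_iff hGD bot_le).2 fun γ hγ _ => ?_)
    by_cases h : γ = δ
    · by_contra h0
      refine hG.not_ge ((hB.le_iff hF hGD).2 fun ε hε h1 => (hz ε hε).2 ?_)
      rintro rfl
      rw [h] at h0
      exact h0 h1
    · exact (hB.le_iff hGD hF).1 hG.le γ hγ ((hz γ hγ).2 h)

/-- The vertex of a chamber opposite to the wall given by a simple normal vector. -/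
def vertex (hB : IsBase D.1 B) (δ : B) : Vertex W := (hB.exists_vertex δ).choose

theorem vertex_le (hB : IsBase D.1 B) (δ : B) : (hB.vertex δ).1 ≤ D.1 :=
  (hB.exists_vertex δ).choose_spec.1

theorem sign_vertex_eq_zero_iff (hB : IsBase D.1 B) (δ : B) {γ : normals W} (hγ : γ ∈ B) :
    (hB.vertex δ).1.sign γ = 0 ↔ γ ≠ δ :=
  (hB.exists_vertex δ).choose_spec.2 γ hγ

theorem vertex_mem_vertices_iff (hB : IsBase D.1 B) {F : Face W} (hF : F ≤ D.1) (δ : B) :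
    hB.vertex δ ∈ F.vertices ↔ F.sign δ ≠ 0 := by
  change (hB.vertex δ).1 ≤ F ↔ _
  rw [hB.le_iff (hB.vertex_le δ) hF]
  refine ⟨fun h h0 => (hB.sign_vertex_eq_zero_iff δ δ.2).1 (h δ δ.2 h0) rfl, fun h γ hγ h0 => ?_⟩
  rw [hB.sign_vertex_eq_zero_iff δ hγ]
  rintro rfl
  exact h h0

theorem vertex_injective (hB : IsBase D.1 B) : Function.Injective hB.vertex := by
  intro δ γ h
  by_contra hne
  have h1 := (hB.sign_vertex_eq_zero_iff γ δ.2).2 fun h => hne (Subtype.ext h)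
  rw [← h, hB.sign_vertex_eq_zero_iff δ δ.2] at h1
  exact h1 rfl

theorem exists_vertex_eq (hB : IsBase D.1 B) {v : Vertex W} (hv : v.1 ≤ D.1) :
    ∃ δ, hB.vertex δ = v := by
  have : ∃ δ ∈ B, v.1.sign δ ≠ 0 := by
    by_contra! h
    exact v.2.1 (le_bot_iff.1 ((hB.le_iff hv bot_le).2 fun δ hδ _ => h δ hδ))
  obtain ⟨δ, hδ, h⟩ := this
  refine ⟨⟨δ, hδ⟩, Subtype.ext ?_⟩
  have hle : (hB.vertex ⟨δ, hδ⟩).1 ≤ v.1 := (hB.vertex_mem_vertices_iff hv ⟨δ, hδ⟩).2 h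
  exact (v.2.le_iff_eq (hB.vertex ⟨δ, hδ⟩).2.1).1 hle

theorem vertices_eq (hB : IsBase D.1 B) {F : Face W} (hF : F ≤ D.1) :
    F.vertices = hB.vertex '' {δ | F.sign δ ≠ 0} := by
  ext v
  constructor
  · intro hv
    obtain ⟨δ, rfl⟩ := hB.exists_vertex_eq (le_trans hv hF)
    exact ⟨δ, (hB.vertex_mem_vertices_iff hF δ).1 hv, rfl⟩
  · rintro ⟨δ, hδ, rfl⟩
    exact (hB.vertex_mem_vertices_iff hF δ).2 hδ

end IsBase

section

/-! ### Adjacent chambers -/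

theorem Face.reflectionIn_smul_eq {F : Face W} {δ : normals W} (h : F.sign δ = 0) :
    reflectionIn δ • F = F := by
  obtain ⟨x, hx⟩ := F.realized
  ext α : 2
  rw [Face.sign_smul, reflectionIn_inv, hx, hx, normals_coe_smul, reflectionIn_apply,
    inner_sub_left, real_inner_smul_left]
  rw [hx, sign_eq_zero_iff] at h
  rw [h, mul_zero, sub_zero]

theorem Chamber.ext_of_sign_one {C D : Chamber W} (h : ∀ α, D.1.sign α = 1 → C.1.sign α = 1) :
    C = D := by
  refine Subtype.ext (Face.ext_of_sign_one fun α => ⟨fun h1 => ?_, h α⟩)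
  rcases D.sign_eq_one_or α with h2 | h2
  · exact h2
  · have := h _ h2
    rw [C.1.sign_neg, h1] at this
    exact absurd this (by decide)

theorem Chamber.sign_reflectionIn_smul (D : Chamber W) (δ : normals W) :
    (reflectionIn δ • D).1.sign δ = -D.1.sign δ := by
  rw [Chamber.coe_smul, Face.sign_smul, reflectionIn_inv, reflectionIn_smul_self, Face.sign_neg]

theorem Chamber.reflectionIn_smul_ne (D : Chamber W) (δ : normals W) :
    reflectionIn δ • D ≠ D := by
  intro h
  have h1 := D.sign_reflectionIn_smul δ
  have h2 := D.2 δ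
  rw [h] at h1
  revert h1 h2
  generalize D.1.sign δ = a
  revert a
  decide

namespace IsBase

variable {D : Chamber W} {B : Finset (normals W)}

/-- The simple normals other than δ are positive on the panel F, so none can occur in the expansion
of a normal vanishing there. -/
theorem exists_eq_smul (hB : IsBase D.1 B) {F : Face W} (hF : F ≤ D.1) {δ : normals W}
    (hδ : δ ∈ B) (hz : ∀ γ ∈ B, F.sign γ = 0 ↔ γ = δ) {α : normals W} (hα : D.1.sign α = 1)
    (h0 : F.sign α = 0) : ∃ c : ℝ, 0 < c ∧ (α : V) = c • (δ : V) := by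
  obtain ⟨c, hc, e⟩ := hB.exists_coeff α hα
  have h1 : ∀ γ ∈ B, γ ≠ δ → c γ = 0 := by
    intro γ hγ hne
    by_contra hcγ
    rw [Face.sign_sum_eq_one hc e (fun ε hε _ => hB.sign_ne_neg_one hF hε) hγ hcγ
      fun h => hne ((hz γ hγ).1 h)] at h0
    exact absurd h0 (by decide)
  have h2 : (α : V) = c δ • (δ : V) := by
    rw [e]
    exact Finset.sum_eq_single_of_mem δ hδ fun γ hγ hne => by rw [h1 γ hγ hne, zero_smul]
  refine ⟨c δ, (hc δ).lt_of_ne' fun h => α.2.1 ?_, h2⟩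
  rw [h2, h, zero_smul]

theorem eq_of_panel_le (hB : IsBase D.1 B) {F : Face W} (hF : F ≤ D.1) {δ : normals W}
    (hδ : δ ∈ B) (hz : ∀ γ ∈ B, F.sign γ = 0 ↔ γ = δ) {E : Chamber W} (hE : F ≤ E.1)
    (h : E.1.sign δ = 1) : E = D := by
  refine Chamber.ext_of_sign_one fun α hα => ?_
  by_cases h0 : F.sign α = 0
  · obtain ⟨c, hc, e⟩ := hB.exists_eq_smul hF hδ hz hα h0
    rw [Face.sign_eq_of_pos_smul _ hc e, h]
  · rw [Face.sign_eq_of_le hE h0, ← hα, Face.sign_eq_of_le hF h0]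

/-- A chamber on the panel F is determined by its side of δ. The reflection fixes F and brings E
back to the side of D. -/
theorem eq_reflectionIn_smul (hB : IsBase D.1 B) {F : Face W} (hF : F ≤ D.1) {δ : normals W}
    (hδ : δ ∈ B) (hz : ∀ γ ∈ B, F.sign γ = 0 ↔ γ = δ) {E : Chamber W} (hE : F ≤ E.1)
    (hne : D ≠ E) : E = reflectionIn δ • D := by
  have h1 : E.1.sign δ = -1 := by
    rw [← E.sign_ne_one]
    exact fun h => hne (hB.eq_of_panel_le hF hδ hz hE h).symm
  have h2 : reflectionIn δ • E = D := by
    refine hB.eq_of_panel_le hF hδ hz ?_ ?_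
    · rw [← Face.reflectionIn_smul_eq ((hz δ hδ).2 rfl)]
      exact Face.smul_le_smul _ hE
    · rw [E.sign_reflectionIn_smul, h1]
      decide
  rw [← h2, smul_smul, reflectionIn_mul_self, one_smul]

variable [FiniteDimensional ℝ V]

theorem exists_panel (hB : IsBase D.1 B) (δ : normals W) :
    ∃ F : Face W, F ≤ D.1 ∧ ∀ γ ∈ B, F.sign γ = 0 ↔ γ = δ :=
  hB.exists_face {δ}

theorem adj_iff (hB : IsBase D.1 B) {E : Chamber W} :
    (chamberGraph W).Adj D E ↔ ∃ δ ∈ B, E = reflectionIn δ • D := by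
  constructor
  · rintro ⟨hne, F, hFD, hFE, hF⟩
    obtain ⟨δ, hδ, hz⟩ := (hB.codim_eq_one_iff hFD).1 hF
    exact ⟨δ, hδ, hB.eq_reflectionIn_smul hFD hδ hz hFE hne⟩
  · rintro ⟨δ, hδ, rfl⟩
    obtain ⟨F, hF, hz⟩ := hB.exists_panel δ
    refine ⟨(D.reflectionIn_smul_ne δ).symm, F, hF, ?_, (hB.codim_eq_one_iff hF).2 ⟨δ, hδ, hz⟩⟩
    rw [← Face.reflectionIn_smul_eq ((hz δ hδ).2 rfl)]
    exact Face.smul_le_smul _ hF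

/-- A simple reflection makes only multiples of δ negative: if α does not vanish on the panel in the
wall of δ, the panel, being fixed by the reflection, forces equal signs of D at α and at its image.
-/
theorem exists_eq_smul_of_sign (hB : IsBase D.1 B) {δ : normals W} (hδ : δ ∈ B) {α : normals W}
    (hα : D.1.sign α = 1) (h : D.1.sign (reflectionIn δ • α) = -1) :
    ∃ c : ℝ, 0 < c ∧ (α : V) = c • (δ : V) := by
  obtain ⟨F, hF, hz⟩ := hB.exists_panel δ
  refine hB.exists_eq_smul hF hδ hz hα ?_
  by_contra h0
  have h1 : F.sign (reflectionIn δ • α) = F.sign α := by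
    conv_rhs => rw [← Face.reflectionIn_smul_eq ((hz δ hδ).2 rfl)]
    rw [Face.sign_smul, reflectionIn_inv]
  have h2 : D.1.sign (reflectionIn δ • α) = D.1.sign α := by
    rw [Face.sign_eq_of_le hF h0, ← h1]
    exact Face.sign_eq_of_le hF (h1 ▸ h0)
  rw [h, hα] at h2
  exact absurd h2 (by decide)

theorem sign_reflectionIn_smul_of_ne (hB : IsBase D.1 B) {δ : normals W} (hδ : δ ∈ B)
    {α : normals W} (hα : α ∈ unitNormals W) (h1 : α ≠ δ) (h2 : α ≠ -δ) :
    (reflectionIn δ • D).1.sign α = D.1.sign α := by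
  rw [Chamber.coe_smul, Face.sign_smul, reflectionIn_inv]
  rcases D.sign_eq_one_or α with h | h
  · rw [h]
    by_contra h3
    obtain ⟨c, -, e⟩ := hB.exists_eq_smul_of_sign hδ h (D.sign_ne_one.1 h3)
    rcases eq_or_eq_neg_of_mem_unitNormals hα (hB.norm_eq δ hδ) e with h | h
    · exact h1 h
    · exact h2 h
  · by_contra h3
    have h4 : D.1.sign (reflectionIn δ • -α) = -1 := by
      rw [← D.sign_ne_one]
      intro h5
      rw [normals_smul_neg, Face.sign_neg] at h5
      rw [Face.sign_neg] at h
      exact h3 (neg_injective (h5.trans h.symm))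
    obtain ⟨c, -, e⟩ := hB.exists_eq_smul_of_sign hδ h h4
    rcases eq_or_eq_neg_of_mem_unitNormals (unitNormals.neg_mem hα) (hB.norm_eq δ hδ) e with h | h
    · exact h2 (by rw [← h]; exact Subtype.ext (neg_neg _).symm)
    · exact h1 (Subtype.ext (neg_injective (congrArg Subtype.val h)))

end IsBase

/-! ### The gallery distance -/

/-- The unit normal vectors of the hyperplanes that separate two chambers. -/
def separating (C D : Chamber W) : Set (normals W) :=
  {α | α ∈ unitNormals W ∧ C.1.sign α = 1 ∧ D.1.sign α = -1}

theorem finite_separating [Finite W] (C D : Chamber W) : (separating C D).Finite :=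
  (finite_unitNormals W).subset fun _ h => h.1

theorem separating_self (C : Chamber W) : separating C C = ∅ := by
  refine Set.eq_empty_of_forall_notMem fun α hα => ?_
  have := hα.2.1.symm.trans hα.2.2
  exact absurd this (by decide)

theorem ncard_separating_le [Finite W] (C D E : Chamber W) :
    (separating C E).ncard ≤ (separating C D).ncard + (separating D E).ncard := by
  refine (Set.ncard_le_ncard ?_ ((finite_separating C D).union (finite_separating D E))).trans
    (Set.ncard_union_le _ _)
  intro α hα
  by_cases h : D.1.sign α = 1
  · exact Or.inr ⟨hα.1, h, hα.2.2⟩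
  · exact Or.inl ⟨hα.1, hα.2.1, D.sign_ne_one.1 h⟩

variable [FiniteDimensional ℝ V]

theorem IsBase.separating_reflectionIn {D : Chamber W} {B : Finset (normals W)}
    (hB : IsBase D.1 B) {δ : normals W} (hδ : δ ∈ B) {C : Chamber W} (h : C.1.sign δ = 1) :
    separating C (reflectionIn δ • D) = insert δ (separating C D) := by
  have h' : C.1.sign (-δ) ≠ 1 := by rw [C.1.sign_neg, h]; decide
  ext α
  by_cases h1 : α = δ
  · subst h1
    refine ⟨fun _ => Set.mem_insert _ _, fun _ => ⟨hB.norm_eq α hδ, h, ?_⟩⟩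
    rw [D.sign_reflectionIn_smul, hB.pos α hδ]
  by_cases h2 : α = -δ
  · subst h2
    exact ⟨fun h3 => absurd h3.2.1 h',
      fun h3 => absurd (Set.mem_of_mem_insert_of_ne h3 h1).2.1 h'⟩
  rw [Set.mem_insert_iff, or_iff_right h1]
  constructor
  · rintro ⟨h3, h4, h5⟩
    exact ⟨h3, h4, by rwa [hB.sign_reflectionIn_smul_of_ne hδ h3 h1 h2] at h5⟩
  · rintro ⟨h3, h4, h5⟩
    exact ⟨h3, h4, by rwa [hB.sign_reflectionIn_smul_of_ne hδ h3 h1 h2]⟩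

/-- When δ is negative on C, the unit normal of the crossed wall that is positive on C is -δ;
crossing this wall towards C removes just it. -/
theorem IsBase.separating_eq_insert {D : Chamber W} {B : Finset (normals W)}
    (hB : IsBase D.1 B) {δ : normals W} (hδ : δ ∈ B) {C : Chamber W} (h : C.1.sign δ = -1) :
    separating C D = insert (-δ) (separating C (reflectionIn δ • D)) := by
  have h' : C.1.sign (-δ) = 1 := by rw [C.1.sign_neg, h]; decide
  ext α
  by_cases h1 : α = -δ
  · subst h1
    refine ⟨fun _ => Set.mem_insert _ _,
      fun _ => ⟨unitNormals.neg_mem (hB.norm_eq δ hδ), h', ?_⟩⟩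
    rw [D.1.sign_neg, hB.pos δ hδ]
  by_cases h2 : α = δ
  · subst h2
    have h3 : C.1.sign α ≠ 1 := by rw [h]; decide
    exact ⟨fun h4 => absurd h4.2.1 h3,
      fun h4 => absurd (Set.mem_of_mem_insert_of_ne h4 h1).2.1 h3⟩
  rw [Set.mem_insert_iff, or_iff_right h1]
  constructor
  · rintro ⟨h3, h4, h5⟩
    exact ⟨h3, h4, by rwa [hB.sign_reflectionIn_smul_of_ne hδ h3 h2 h1]⟩
  · rintro ⟨h3, h4, h5⟩
    exact ⟨h3, h4, by rwa [hB.sign_reflectionIn_smul_of_ne hδ h3 h2 h1] at h5⟩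

variable [Finite W]

theorem IsBase.ncard_separating_add_one {D : Chamber W} {B : Finset (normals W)}
    (hB : IsBase D.1 B) {δ : normals W} (hδ : δ ∈ B) {C : Chamber W} (h : C.1.sign δ = -1) :
    (separating C (reflectionIn δ • D)).ncard + 1 = (separating C D).ncard := by
  rw [hB.separating_eq_insert hδ h, Set.ncard_insert_of_notMem _ (finite_separating _ _)]
  intro h1
  have := h1.2.2
  rw [Face.sign_neg, D.sign_reflectionIn_smul, hB.pos δ hδ] at this
  exact absurd this (by decide)

theorem IsBase.ncard_separating_reflectionIn {D : Chamber W} {B : Finset (normals W)}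
    (hB : IsBase D.1 B) {δ : normals W} (hδ : δ ∈ B) {C : Chamber W} (h : C.1.sign δ = 1) :
    (separating C (reflectionIn δ • D)).ncard = (separating C D).ncard + 1 := by
  rw [hB.separating_reflectionIn hδ h, Set.ncard_insert_of_notMem _ (finite_separating _ _)]
  intro h1
  have := h1.2.2
  rw [hB.pos δ hδ] at this
  exact absurd this (by decide)

theorem ncard_separating_le_length {C D : Chamber W} (p : (chamberGraph W).Walk C D) :
    (separating C D).ncard ≤ p.length := by
  induction p with
  | nil => rw [separating_self, Set.ncard_empty]; exact Nat.zero_le _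
  | @cons C E D h p ih =>
    obtain ⟨B, hB⟩ := C.exists_isBase
    obtain ⟨δ, hδ, rfl⟩ := hB.adj_iff.1 h
    have h1 := hB.ncard_separating_reflectionIn hδ (hB.pos δ hδ)
    rw [separating_self, Set.ncard_empty] at h1
    have h2 := ncard_separating_le C (reflectionIn δ • C) D
    rw [SimpleGraph.Walk.length_cons]
    omega

/-- If C differs from D, some simple normal of D is negative on C, and reflecting D in that wall
removes exactly one separating hyperplane. -/
theorem exists_walk_length_eq (C D : Chamber W) :
    ∃ p : (chamberGraph W).Walk C D, p.length = (separating C D).ncard := by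
  induction hn : (separating C D).ncard generalizing D with
  | zero =>
    obtain ⟨B, hB⟩ := D.exists_isBase
    have : C = D := hB.eq_of_sign_eq_one fun δ hδ => by
      by_contra h
      have := hB.ncard_separating_add_one hδ (C.sign_ne_one.1 h)
      omega
    subst this
    exact ⟨.nil, rfl⟩
  | succ n ih =>
    obtain ⟨B, hB⟩ := D.exists_isBase
    by_cases h : ∀ δ ∈ B, C.1.sign δ = 1
    · rw [hB.eq_of_sign_eq_one h, separating_self, Set.ncard_empty] at hn
      exact absurd hn (by omega)
    push Not at h
    obtain ⟨δ, hδ, h⟩ := h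
    obtain ⟨p, hp⟩ := ih (reflectionIn δ • D) (by
      have := hB.ncard_separating_add_one hδ (C.sign_ne_one.1 h)
      omega)
    refine ⟨p.concat (hB.adj_iff.2 ⟨δ, hδ, rfl⟩).symm, ?_⟩
    rw [SimpleGraph.Walk.length_concat, hp]

theorem dist_eq_ncard_separating (C D : Chamber W) :
    (chamberGraph W).dist C D = (separating C D).ncard := by
  obtain ⟨p, hp⟩ := exists_walk_length_eq C D
  refine le_antisymm (hp ▸ SimpleGraph.dist_le p) ?_
  obtain ⟨q, hq⟩ := SimpleGraph.Reachable.exists_walk_length_eq_dist ⟨p⟩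
  exact hq ▸ ncard_separating_le_length q

end

section

/-! ### Types and descents -/

variable {I : Type*}

theorem IsBase.mem_type_iff [FiniteDimensional ℝ V] {D : Chamber W} {B : Finset (normals W)}
    (hB : IsBase D.1 B) {τ : Vertex W → I} (hτ : Function.Injective fun δ => τ (hB.vertex δ))
    {F : Face W} (hF : F ≤ D.1) (δ : B) : τ (hB.vertex δ) ∈ F.type τ ↔ F.sign δ ≠ 0 := by
  rw [Face.type, hB.vertices_eq hF, ← Set.image_comp]
  exact hτ.mem_set_image (f := fun δ => τ (hB.vertex δ))

/-- A map on vertices that is bijective on the vertices of each chamber. -/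
def BijectiveOnChambers (τ : Vertex W → I) : Prop :=
  ∀ D : Chamber W, Set.BijOn τ D.1.vertices Set.univ

section

variable [FiniteDimensional ℝ V] {D : Chamber W} {B : Finset (normals W)} {τ : Vertex W → I}

theorem BijectiveOnChambers.bijective (hτ : BijectiveOnChambers τ) (hB : IsBase D.1 B) :
    Function.Bijective fun δ => τ (hB.vertex δ) := by
  constructor
  · intro δ γ h
    exact hB.vertex_injective ((hτ D).injOn (hB.vertex_le δ) (hB.vertex_le γ) h)
  · intro i
    obtain ⟨v, hv, rfl⟩ := (hτ D).surjOn (Set.mem_univ i)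
    obtain ⟨δ, rfl⟩ := hB.exists_vertex_eq hv
    exact ⟨δ, rfl⟩

theorem BijectiveOnChambers.eq_of_type_eq [Finite W] (hτ : BijectiveOnChambers τ) {F G : Face W}
    (hF : F ≤ D.1) (hG : G ≤ D.1) (h : F.type τ = G.type τ) : F = G := by
  obtain ⟨B, hB⟩ := D.exists_isBase
  have hi := (hτ.bijective hB).injective
  refine hB.ext_face hF hG fun δ hδ => not_iff_not.1 ?_
  rw [← ne_eq, ← ne_eq, ← hB.mem_type_iff hi hF ⟨δ, hδ⟩, h, hB.mem_type_iff hi hG ⟨δ, hδ⟩]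

theorem BijectiveOnChambers.exists_face [Finite W] (hτ : BijectiveOnChambers τ) (D : Chamber W)
    (J : Set I) : ∃ F : Face W, F ≤ D.1 ∧ F.type τ = J := by
  obtain ⟨B, hB⟩ := D.exists_isBase
  have hb := hτ.bijective hB
  obtain ⟨F, hF, hz⟩ := hB.exists_face {δ | ∀ h : δ ∈ B, τ (hB.vertex ⟨δ, h⟩) ∉ J}
  refine ⟨F, hF, Set.ext fun i => ?_⟩
  obtain ⟨δ, rfl⟩ := hb.surjective i
  dsimp only
  rw [hB.mem_type_iff hb.injective hF δ, ne_eq, hz δ δ.2]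
  simp

/-- The last step of a minimal gallery must cross a wall separating D from C, and conversely
crossing such a wall reduces the distance by one. -/
theorem mem_descentSet_iff [Finite W] (hτ : BijectiveOnChambers τ) (hB : IsBase D.1 B)
    {C : Chamber W} (δ : B) : τ (hB.vertex δ) ∈ descentSet τ C D ↔ C.1.sign δ = -1 := by
  have hb := hτ.bijective hB
  constructor
  · rintro ⟨E, p, h, hp, hne, F, hFE, hFD, hF, ht⟩
    obtain ⟨ε, hε, hz⟩ := (hB.codim_eq_one_iff hFD).1 hF
    have hE := hB.eq_reflectionIn_smul hFD hε hz hFE hne.symm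
    -- The type of the common panel omits the label of the vertex at δ, so the panel vanishes at δ;
    -- but it vanishes at ε only.
    have h1 : (δ : normals W) = ε := by
      rw [← hz δ δ.2]
      by_contra h0
      have := (hB.mem_type_iff hb.injective hFD δ).2 h0
      rw [ht] at this
      exact this rfl
    rw [h1, ← C.sign_ne_one]
    intro h2
    have h3 := hB.ncard_separating_reflectionIn hε h2
    rw [← hE] at h3
    have h4 := ncard_separating_le_length p
    rw [SimpleGraph.Walk.length_concat, dist_eq_ncard_separating] at hp
    omega
  · intro h
    have hadj := (hB.adj_iff (E := reflectionIn δ.1 • D)).2 ⟨δ, δ.2, rfl⟩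
    obtain ⟨p, hp⟩ := exists_walk_length_eq C (reflectionIn δ.1 • D)
    refine ⟨reflectionIn δ.1 • D, p, hadj.symm, ?_, hadj.1.symm, ?_⟩
    · rw [SimpleGraph.Walk.length_concat, hp, dist_eq_ncard_separating,
        hB.ncard_separating_add_one δ.2 h]
    · obtain ⟨F, hF, hz⟩ := hB.exists_panel δ.1
      refine ⟨F, ?_, hF, (hB.codim_eq_one_iff hF).2 ⟨δ, δ.2, hz⟩, Set.ext fun i => ?_⟩
      · rw [← Face.reflectionIn_smul_eq ((hz δ δ.2).2 rfl)]
        exact Face.smul_le_smul _ hF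
      · obtain ⟨γ, rfl⟩ := hb.surjective i
        dsimp only
        rw [hB.mem_type_iff hb.injective hF γ, ne_eq, hz γ γ.2, Set.mem_compl_iff,
          Set.mem_singleton_iff, hb.injective.eq_iff, Subtype.coe_inj]

end

/-! ### The product of a face and a chamber -/

-- Start at a point x of F and move slightly towards a point y of C, to x + ty. Nonzero signs at x
-- persist, zero signs become those of C, and a single t serves all the finitely many unit normals.
open Filter Topology in
theorem Face.exists_product [Finite W] (F : Face W) (C : Chamber W) :
    ∃ D : Chamber W, F ≤ D.1 ∧ ∀ α, F.sign α = 0 → D.1.sign α = C.1.sign α := by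
  obtain ⟨x, hx⟩ := F.realized
  obtain ⟨y, hy⟩ := C.1.realized
  have key : ∀ α ∈ unitNormals W, ∀ᶠ t : ℝ in 𝓝[>] 0, SignType.sign (inner ℝ (α : V) (x + t • y)) =
      if F.sign α = 0 then C.1.sign α else F.sign α := by
    intro α _
    rw [hx, hy]
    simp only [inner_add_right, real_inner_smul_right]
    have hlim : Tendsto (fun t : ℝ => inner ℝ (α : V) x + t * inner ℝ (α : V) y) (𝓝[>] 0)
        (𝓝 (inner ℝ (α : V) x)) := by
      have : Continuous fun t : ℝ => inner ℝ (α : V) x + t * inner ℝ (α : V) y := by fun_prop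
      simpa using (this.tendsto 0).mono_left nhdsWithin_le_nhds
    rcases lt_trichotomy (inner ℝ (α : V) x) 0 with h | h | h
    · filter_upwards [hlim.eventually_lt_const h] with t ht
      rw [_root_.sign_neg ht, _root_.sign_neg h, if_neg (by decide)]
    · filter_upwards [self_mem_nhdsWithin] with t ht
      rw [h, zero_add, sign_mul, sign_pos ht, one_mul, sign_zero, if_pos rfl]
    · filter_upwards [hlim.eventually_const_lt h] with t ht
      rw [sign_pos ht, sign_pos h, if_neg (by decide)]
  obtain ⟨t, ht⟩ := ((eventually_all_finite (finite_unitNormals W)).2 key).exists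
  let D : Face W := ⟨fun α => SignType.sign (inner ℝ (α : V) (x + t • y)), x + t • y, fun _ => rfl⟩
  have hD : ∀ α, D.sign α = if F.sign α = 0 then C.1.sign α else F.sign α := by
    intro α
    obtain ⟨β, hβ, c, hc, e⟩ := exists_unit α
    rw [D.sign_eq_of_pos_smul hc e, F.sign_eq_of_pos_smul hc e, C.1.sign_eq_of_pos_smul hc e]
    exact ht β hβ
  refine ⟨⟨D, fun α => ?_⟩, fun α => ?_, fun α h => ?_⟩
  · rw [hD]
    split_ifs with h
    · exact C.2 α
    · exact h
  · by_cases h : F.sign α = 0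
    · exact Or.inl h
    · right
      rw [hD, if_neg h]
  · exact (hD α).trans (if_pos h)

theorem Face.product_unique {F : Face W} {C D E : Chamber W} (hD : F ≤ D.1)
    (hD' : ∀ α, F.sign α = 0 → D.1.sign α = C.1.sign α) (hE : F ≤ E.1)
    (hE' : ∀ α, F.sign α = 0 → E.1.sign α = C.1.sign α) : D = E := by
  refine Subtype.ext (Face.ext (funext fun α => ?_))
  by_cases h : F.sign α = 0
  · rw [hD' α h, hE' α h]
  · rw [Face.sign_eq_of_le hD h, Face.sign_eq_of_le hE h]

/-! ### Counting -/

section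

variable [FiniteDimensional ℝ V] [Finite W] {τ : Vertex W → I}

/-- The inclusion says that every simple normal of D vanishing on F is positive on C. The normals
that vanish on F and are positive on D are nonnegative combinations of these, so they too are
positive on C. -/
theorem descentSet_subset_type_iff (hτ : BijectiveOnChambers τ) {C D : Chamber W} {F : Face W}
    (hF : F ≤ D.1) :
    descentSet τ C D ⊆ F.type τ ↔ ∀ α, F.sign α = 0 → D.1.sign α = C.1.sign α := by
  obtain ⟨B, hB⟩ := D.exists_isBase
  have hb := hτ.bijective hB
  constructor
  · intro h
    have key : ∀ α, D.1.sign α = 1 → F.sign α = 0 → C.1.sign α = 1 := by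
      intro α h1 h0
      obtain ⟨c, hc, e⟩ := hB.exists_coeff α h1
      have hpos : ∀ δ ∈ B, c δ ≠ 0 → C.1.sign δ = 1 := by
        intro δ hδ hcδ
        by_contra h2
        have h3 := h ((mem_descentSet_iff hτ hB ⟨δ, hδ⟩).2 (C.sign_ne_one.1 h2))
        rw [hB.mem_type_iff hb.injective hF] at h3
        rw [Face.sign_sum_eq_one hc e (fun γ hγ _ => hB.sign_ne_neg_one hF hγ) hδ hcδ h3] at h0
        exact absurd h0 (by decide)
      obtain ⟨δ, hδ, hcδ⟩ := exists_coeff_ne_zero e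
      exact Face.sign_sum_eq_one hc e (fun γ hγ h => by rw [hpos γ hγ h]; decide) hδ hcδ (C.2 δ)
    intro α h0
    rcases D.sign_eq_one_or α with h1 | h1
    · rw [h1, key α h1 h0]
    · have := key _ h1 (by rw [F.sign_neg, h0]; decide)
      rw [Face.sign_neg] at this h1
      exact neg_injective (h1.trans this.symm)
  · intro h i hi
    obtain ⟨δ, rfl⟩ := hb.surjective i
    dsimp only at hi ⊢
    rw [mem_descentSet_iff hτ hB] at hi
    rw [hB.mem_type_iff hb.injective hF]
    intro h0
    have := h δ h0
    rw [hi, hB.pos δ δ.2] at this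
    exact absurd this (by decide)

/-- The bijection is F ↦ FC. It is injective because a chamber has at most one face of each type,
and surjective because it has one of type J. -/
theorem fVector_eq_ncard (hτ : BijectiveOnChambers τ) (C : Chamber W) (J : Finset I) :
    fVector τ J = {D : Chamber W | descentSet τ C D ⊆ J}.ncard := by
  choose f hf hf' using fun F : Face W => F.exists_product C
  refine Set.ncard_congr (fun F _ => f F) ?_ ?_ ?_
  · intro F hF
    change descentSet τ C (f F) ⊆ J
    rw [← show F.type τ = J from hF, descentSet_subset_type_iff hτ (hf F)]
    exact hf' F
  · intro F G hF hG h
    exact hτ.eq_of_type_eq (hf F) (h ▸ hf G) (Eq.trans hF (Eq.symm hG))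
  · intro D hD
    obtain ⟨F, hF, ht⟩ := hτ.exists_face D J
    refine ⟨F, ht, Face.product_unique (hf F) (hf' F) hF ?_⟩
    rw [← descentSet_subset_type_iff hτ hF, ht]
    exact hD

end

/-- Möbius inversion on subsets: complementing in J turns the sum into an alternating sum over the
subsets of J \ S, which vanishes unless J \ S is empty. -/
theorem sum_powerset_neg_one_pow_card_sdiff [DecidableEq I] (S J : Finset I) :
    ∑ K ∈ J.powerset, (-1 : ℤ) ^ (J \ K).card * (if S ⊆ K then 1 else 0) =
      if S = J then 1 else 0 := by
  by_cases hS : S ⊆ J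
  · have h1 : ∑ K ∈ J.powerset, (-1 : ℤ) ^ (J \ K).card * (if S ⊆ K then 1 else 0) =
        ∑ L ∈ (J \ S).powerset, (-1 : ℤ) ^ L.card := by
      simp only [mul_ite, mul_one, mul_zero]
      rw [← Finset.sum_filter]
      refine Finset.sum_nbij' (fun K => J \ K) (fun L => J \ L) ?_ ?_ ?_ ?_ ?_
      · intro K hK
        rw [Finset.mem_filter, Finset.mem_powerset] at hK
        exact Finset.mem_powerset.2 (Finset.sdiff_subset_sdiff le_rfl hK.2)
      · intro L hL
        rw [Finset.mem_powerset] at hL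
        rw [Finset.mem_filter, Finset.mem_powerset]
        exact ⟨Finset.sdiff_subset, fun i hi => Finset.mem_sdiff.2
          ⟨hS hi, fun h => (Finset.mem_sdiff.1 (hL h)).2 hi⟩⟩
      · intro K hK
        rw [Finset.mem_filter, Finset.mem_powerset] at hK
        exact Finset.sdiff_sdiff_eq_self hK.1
      · intro L hL
        exact Finset.sdiff_sdiff_eq_self ((Finset.mem_powerset.1 hL).trans Finset.sdiff_subset)
      · intro K _
        rfl
    rw [h1, Finset.sum_powerset_neg_one_pow_card]
    refine if_congr ?_ rfl rfl
    rw [Finset.sdiff_eq_empty_iff_subset]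
    exact ⟨fun h => hS.antisymm h, fun h => h ▸ le_rfl⟩
  · rw [if_neg (fun h => hS h.le)]
    refine Finset.sum_eq_zero fun K hK => ?_
    rw [if_neg (fun h => hS (h.trans (Finset.mem_powerset.1 hK))), mul_zero]

theorem betaChambers_eq_hVector [FiniteDimensional ℝ V] [Finite W] [Finite I] [DecidableEq I]
    {τ : Vertex W → I} (hτ : BijectiveOnChambers τ) (C : Chamber W) (J : Finset I) :
    (betaChambers τ C J : ℤ) = hVector τ J := by
  classical
  have := Fintype.ofFinite (Chamber W)
  let d : Chamber W → Finset I := fun D => (Set.toFinite (descentSet τ C D)).toFinset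
  have hd : ∀ D, (d D : Set I) = descentSet τ C D := fun D => Set.Finite.coe_toFinset _
  have hf : ∀ K : Finset I, (fVector τ K : ℤ) = ∑ D : Chamber W, if d D ⊆ K then 1 else 0 := by
    intro K
    rw [fVector_eq_ncard hτ C, Finset.sum_boole, Set.ncard_eq_toFinset_card']
    congr 2
    ext D
    simp [← hd]
  rw [hVector]
  simp_rw [hf, Finset.mul_sum]
  rw [Finset.sum_comm]
  simp_rw [sum_powerset_neg_one_pow_card_sdiff]
  rw [betaChambers, Finset.sum_boole, Set.ncard_eq_toFinset_card']
  congr 2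
  ext D
  simp [← hd]

end

/-! ### Simple transitivity -/

theorem ncard_separating_smul (w : W) (C D : Chamber W) :
    (separating (w • C) (w • D)).ncard = (separating C D).ncard := by
  have : separating (w • C) (w • D) = (fun α => w • α) '' separating C D := by
    ext α
    obtain ⟨β, rfl⟩ : ∃ β : normals W, w • β = α := ⟨w⁻¹ • α, smul_inv_smul w α⟩
    rw [(MulAction.injective w).mem_set_image]
    simp [separating, Face.sign_smul_smul, unitNormals]
  rw [this, Set.ncard_image_of_injective _ (MulAction.injective w)]

theorem normals_smul_reflectionIn_self (w : W) (δ : normals W) :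
    (w * reflectionIn δ) • δ = -(w • δ) := by
  rw [mul_smul, reflectionIn_smul_self, normals_smul_neg]

section

variable [FiniteDimensional ℝ V] {C : Chamber W} {B : Finset (normals W)}

/-- Apply the letters to δ from the right. At the letter ε where the sign turns negative, the suffix
u sends δ to a multiple of ε, so u conjugates the reflection in δ to that in ε, and this letter
cancels. -/
theorem IsBase.exchange (hB : IsBase C.1 B) {δ : normals W} (hδ : δ ∈ B) :
    ∀ L : List (normals W), (∀ γ ∈ L, γ ∈ B) → C.1.sign ((L.map reflectionIn).prod • δ) = -1 →
      ∃ L' : List (normals W), (∀ γ ∈ L', γ ∈ B) ∧ L'.length + 1 = L.length ∧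
        (L.map reflectionIn).prod * reflectionIn δ = (L'.map reflectionIn).prod
  | [], _, h => by
    rw [List.map_nil, List.prod_nil, one_smul, hB.pos δ hδ] at h
    exact absurd h (by decide)
  | ε :: L, hL, h => by
    have hε : ε ∈ B := hL ε List.mem_cons_self
    have hL' : ∀ γ ∈ L, γ ∈ B := fun γ hγ => hL γ (List.mem_cons_of_mem _ hγ)
    set u := (L.map reflectionIn).prod with hu
    rw [List.map_cons, List.prod_cons, ← hu] at h ⊢
    by_cases h1 : C.1.sign (u • δ) = 1
    · rw [mul_smul] at h
      obtain ⟨c, -, e⟩ := hB.exists_eq_smul_of_sign hε h1 h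
      have h2 := reflectionIn_eq_of_coe_eq_smul e
      rw [reflectionIn_smul] at h2
      refine ⟨L, hL', rfl, ?_⟩
      rw [← hu, ← h2, inv_mul_cancel_right, mul_assoc, reflectionIn_mul_self, mul_one]
    · obtain ⟨L', h2, h3, h4⟩ := exchange hB hδ L hL' (C.sign_ne_one.1 h1)
      refine ⟨ε :: L', ?_, by simp [← h3], ?_⟩
      · simpa [hε] using h2
      · rw [mul_assoc, h4, List.map_cons, List.prod_cons]

/-- If a word fixes C, the word without its last letter δ makes δ negative; exchange then gives an
equal word shorter by two letters. -/
theorem IsBase.word_eq_one (hB : IsBase C.1 B) (L : List (normals W)) (hL : ∀ γ ∈ L, γ ∈ B)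
    (h : (L.map reflectionIn).prod • C = C) : (L.map reflectionIn).prod = 1 := by
  induction hn : L.length using Nat.strong_induction_on generalizing L with
  | _ n ih =>
    subst hn
    rcases List.eq_nil_or_concat L with rfl | ⟨L, δ, rfl⟩
    · rfl
    have hδ : δ ∈ B := hL δ (by simp)
    have hprod : ((L.concat δ).map reflectionIn).prod =
        (L.map reflectionIn).prod * reflectionIn δ := by simp
    rw [hprod] at h ⊢
    have h1 : C.1.sign ((L.map reflectionIn).prod • δ) = -1 := by
      have h2 := Face.sign_smul_smul ((L.map reflectionIn).prod * reflectionIn δ) C.1 δ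
      rw [← Chamber.coe_smul, h, normals_smul_reflectionIn_self, Face.sign_neg, hB.pos δ hδ] at h2
      exact neg_eq_iff_eq_neg.1 h2
    obtain ⟨L', h2, h3, h4⟩ := hB.exchange hδ L (fun γ hγ => hL γ (by simp [hγ])) h1
    rw [h4] at h ⊢
    exact ih L'.length (by simp; omega) L' h2 h rfl

/-- Among the positive normals in the orbit of α under the simple reflections, take the lowest,
height being measured against a point of C. A simple reflection that would lower it further must
make it negative, so it is a multiple of a simple normal. -/
theorem IsBase.reflectionIn_mem_closure_of_unit [Finite W] (hB : IsBase C.1 B) {α : normals W}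
    (hα : α ∈ unitNormals W) (hs : C.1.sign α = 1) :
    reflectionIn α ∈ Subgroup.closure (reflectionIn '' (B : Set (normals W))) := by
  set G := Subgroup.closure (reflectionIn '' (B : Set (normals W))) with hG
  have hBG : ∀ δ ∈ B, reflectionIn δ ∈ G := fun δ hδ => Subgroup.subset_closure ⟨δ, hδ, rfl⟩
  obtain ⟨x, hx⟩ := C.1.realized
  have hfin : {β | β ∈ unitNormals W ∧ C.1.sign β = 1 ∧ ∃ g ∈ G, β = g • α}.Finite :=
    (finite_unitNormals W).subset fun _ h => h.1
  obtain ⟨β, ⟨hβ, hβs, g, hg, hgβ⟩, hmin⟩ := Set.exists_min_image _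
    (fun β : normals W => inner ℝ (β : V) x) hfin ⟨α, hα, hs, 1, G.one_mem, (one_smul _ _).symm⟩
  suffices h : reflectionIn β ∈ G by
    rw [hgβ, reflectionIn_smul] at h
    exact (G.mul_mem_cancel_left hg).1 ((G.mul_mem_cancel_right (G.inv_mem hg)).1 h)
  obtain ⟨c, hc, e⟩ := hB.exists_coeff β hβs
  have hpos : 0 < ∑ δ ∈ B, c δ * inner ℝ (δ : V) (β : V) := by
    have h1 : inner ℝ (β : V) (β : V) = ∑ δ ∈ B, c δ * inner ℝ (δ : V) (β : V) := by
      nth_rewrite 1 [e]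
      rw [sum_inner]
      simp only [real_inner_smul_left]
    rw [← h1]
    exact real_inner_self_pos.2 β.2.1
  -- The squared norm of β is a sum over the base, so some term is positive; reflecting in that δ
  -- subtracts a positive multiple of δ.
  obtain ⟨δ, hδ, h2⟩ := Finset.exists_lt_of_sum_lt (f := fun _ => (0 : ℝ)) (by simpa using hpos)
  have h3 : 0 < inner ℝ (δ : V) (β : V) := pos_of_mul_pos_right h2 (hc δ)
  by_cases h4 : C.1.sign (reflectionIn δ • β) = 1
  · have h5 := hmin (reflectionIn δ • β) ⟨unitNormals.smul_mem _ hβ, h4, reflectionIn δ * g,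
      G.mul_mem (hBG δ hδ) hg, by rw [hgβ, mul_smul]⟩
    rw [normals_coe_smul, reflectionIn_apply_of_norm (hB.norm_eq δ hδ), inner_sub_left,
      real_inner_smul_left] at h5
    have h6 := hB.pos δ hδ
    rw [hx, sign_eq_one_iff] at h6
    have := mul_pos h3 h6
    linarith
  · obtain ⟨c, -, e⟩ := hB.exists_eq_smul_of_sign hδ hβs (C.sign_ne_one.1 h4)
    rw [reflectionIn_eq_of_coe_eq_smul e]
    exact hBG δ hδ

theorem IsBase.reflectionIn_mem_closure [Finite W] (hB : IsBase C.1 B) (α : normals W) :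
    reflectionIn α ∈ Subgroup.closure (reflectionIn '' (B : Set (normals W))) := by
  obtain ⟨β, hβ, c, -, e⟩ := exists_unit α
  rw [reflectionIn_eq_of_coe_eq_smul e]
  rcases C.sign_eq_one_or β with h | h
  · exact hB.reflectionIn_mem_closure_of_unit hβ h
  · rw [reflectionIn_eq_of_coe_eq_smul (α := β) (β := -β) (c := -1) (by simp)]
    exact hB.reflectionIn_mem_closure_of_unit (unitNormals.neg_mem hβ) h

theorem IsBase.closure_eq_top (hW : IsFiniteReflectionGroup W) (hB : IsBase C.1 B) :
    Subgroup.closure (reflectionIn '' (B : Set (normals W))) = ⊤ := by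
  have := hW.finite
  obtain ⟨S, hS, hSW⟩ := hW.generated
  set G := Subgroup.closure (reflectionIn '' (B : Set (normals W))) with hG
  have hle : Subgroup.closure S ≤ G.map W.subtype := by
    rw [Subgroup.closure_le]
    intro s hs
    obtain ⟨α, hα, rfl⟩ := hS s hs
    have hmem : (Submodule.span ℝ {α})ᗮ.reflection ∈ W := hSW ▸ Subgroup.subset_closure hs
    exact ⟨reflectionIn ⟨α, hα, hmem⟩, hB.reflectionIn_mem_closure _, rfl⟩
  refine top_le_iff.1 fun w _ => ?_
  obtain ⟨g, hg, h⟩ := hle (show w.1 ∈ Subgroup.closure S by rw [hSW]; exact w.2)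
  rwa [← show g = w from Subtype.ext h]

theorem IsBase.exists_word (hW : IsFiniteReflectionGroup W) (hB : IsBase C.1 B) (w : W) :
    ∃ L : List (normals W), (∀ γ ∈ L, γ ∈ B) ∧ (L.map reflectionIn).prod = w := by
  have hw : w ∈ Subgroup.closure (reflectionIn '' (B : Set (normals W))) :=
    hB.closure_eq_top hW ▸ Subgroup.mem_top w
  induction hw using Subgroup.closure_induction with
  | mem x hx =>
    obtain ⟨δ, hδ, rfl⟩ := hx
    exact ⟨[δ], by simpa using hδ, by simp⟩
  | one => exact ⟨[], by simp, rfl⟩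
  | mul x y _ _ hx hy =>
    obtain ⟨L, hL, rfl⟩ := hx
    obtain ⟨M, hM, rfl⟩ := hy
    refine ⟨L ++ M, fun γ hγ => ?_, by simp⟩
    exact (List.mem_append.1 hγ).elim (hL γ) (hM γ)
  | inv x _ hx =>
    obtain ⟨L, hL, rfl⟩ := hx
    refine ⟨L.reverse, fun γ hγ => hL γ (List.mem_reverse.1 hγ), ?_⟩
    rw [List.prod_inv_reverse, List.map_map, List.map_reverse]
    congr 3

theorem eq_one_of_smul_eq (hW : IsFiniteReflectionGroup W) {w : W} (h : w • C = C) : w = 1 := by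
  have := hW.finite
  obtain ⟨B, hB⟩ := C.exists_isBase
  obtain ⟨L, hL, rfl⟩ := hB.exists_word hW w
  exact hB.word_eq_one L hL h

theorem exists_smul_eq [Finite W] (C D : Chamber W) : ∃ w : W, w • C = D := by
  obtain ⟨p, -⟩ := exists_walk_length_eq C D
  induction p with
  | nil => exact ⟨1, one_smul _ _⟩
  | @cons C E D h p ih =>
    obtain ⟨B, hB⟩ := C.exists_isBase
    obtain ⟨δ, hδ, rfl⟩ := hB.adj_iff.1 h
    obtain ⟨w, rfl⟩ := ih
    exact ⟨w * reflectionIn δ, mul_smul _ _ _⟩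

/-! ### Existence of a labelling -/

/-- The closure of a chamber is a fundamental domain. -/
theorem smul_eq_self_of_le (hW : IsFiniteReflectionGroup W) {F : Face W} (hF : F ≤ C.1) {u : W}
    (hu : u • F ≤ C.1) : u • F = F := by
  have := hW.finite
  obtain ⟨B, hB⟩ := C.exists_isBase
  -- Induction on the number of hyperplanes separating uC from C.
  induction hn : (separating (u • C) C).ncard using Nat.strong_induction_on generalizing u with
  | _ n ih =>
    subst hn
    by_cases h : ∀ δ ∈ B, (u • C).1.sign δ = 1
    · rw [eq_one_of_smul_eq hW (hB.eq_of_sign_eq_one h), one_smul]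
    push Not at h
    obtain ⟨δ, hδ, h⟩ := h
    rw [Chamber.sign_ne_one] at h
    -- The wall of δ separates uC from C, while uF is a face of both, so uF lies in the wall and is
    -- fixed by its reflection.
    have h0 : (u • F).sign δ = 0 := by
      by_contra h0
      have h1 := Face.sign_eq_of_le (Face.smul_le_smul u hF) h0
      have h2 := Face.sign_eq_of_le hu h0
      rw [← h1, hB.pos δ hδ, ← Chamber.coe_smul, h] at h2
      exact absurd h2 (by decide)
    have h1 : (reflectionIn δ * u) • F = u • F := by
      rw [mul_smul, Face.reflectionIn_smul_eq h0]
    rw [← h1]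
    refine ih _ ?_ (h1.symm ▸ hu) rfl
    have h2 := hB.ncard_separating_add_one hδ h
    have h3 := ncard_separating_smul (reflectionIn δ) (u • C) (reflectionIn δ • C)
    rw [smul_smul, smul_smul, reflectionIn_mul_self, one_smul] at h3
    omega

end

theorem Face.smul_bot (w : W) : w • (⊥ : Face W) = ⊥ := rfl

theorem Face.le_smul_iff (w : W) {F G : Face W} : F ≤ w • G ↔ w⁻¹ • F ≤ G := by
  rw [← Face.smul_le_smul_iff w⁻¹, inv_smul_smul]

theorem isAtom_smul (w : W) {F : Face W} (hF : IsAtom F) : IsAtom (w • F) := by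
  refine ⟨fun h => hF.1 ?_, fun G hG => ?_⟩
  · rw [← inv_smul_smul w F, h, Face.smul_bot]
  · have h := hF.2 (w⁻¹ • G) (lt_of_le_not_ge ((Face.le_smul_iff w).1 hG.le) fun h => hG.not_ge (by
      simpa using Face.smul_le_smul w h))
    rw [← smul_inv_smul w G, h, Face.smul_bot]

theorem Vertex.exists_smul_eq [FiniteDimensional ℝ V] [Finite W] (C : Chamber W) (v : Vertex W) :
    ∃ (u : W) (x : C.1.vertices), v.1 = u • x.1.1 := by
  obtain ⟨D, hD, -⟩ := v.1.exists_product C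
  obtain ⟨w, rfl⟩ := CoxeterComplex.exists_smul_eq C D
  exact ⟨w, ⟨⟨w⁻¹ • v.1, isAtom_smul _ v.2⟩, (Face.le_smul_iff w).1 hD⟩, (smul_inv_smul w _).symm⟩

/-- Label each vertex by a vertex of C in its W-orbit. -/
theorem exists_isLabelling [FiniteDimensional ℝ V] (hW : IsFiniteReflectionGroup W)
    (C : Chamber W) : ∃ τ : Vertex W → Fin C.rank, IsLabelling C τ := by
  have := hW.finite
  choose u ρ hρ using Vertex.exists_smul_eq C
  let e : C.1.vertices ≃ Fin C.rank := Finite.equivFinOfCardEq (Nat.card_coe_set_eq _)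
  refine ⟨fun v => e (ρ v), inferInstance, Nat.card_fin _, ?_⟩
  rintro v v' hne ⟨F, hv, hv'⟩ h
  obtain ⟨D, hD, -⟩ := F.exists_product C
  obtain ⟨w, rfl⟩ := exists_smul_eq C D
  -- For x a vertex of wC, both w⁻¹x and the chosen representative are vertices of C in one orbit;
  -- they coincide because the closed chamber is a fundamental domain.
  have key : ∀ x : Vertex W, x.1 ≤ F → w⁻¹ • x.1 = (ρ x).1.1 := by
    intro x hx
    have h1 : w⁻¹ • x.1 ≤ C.1 := (Face.le_smul_iff w).1 (hx.trans hD)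
    rw [hρ x, smul_smul] at h1 ⊢
    exact smul_eq_self_of_le hW (ρ x).2 h1
  have h1 := key v hv
  rw [e.injective h, ← key v' hv'] at h1
  exact hne (Subtype.ext (MulAction.injective _ h1))

/-! ### Arbitrary labellings, and chambers versus group elements. -/

theorem ncard_vertices_smul (w : W) (C : Chamber W) :
    (w • C).1.vertices.ncard = C.1.vertices.ncard := by
  refine (Set.ncard_congr (fun v _ => ⟨w • v.1, isAtom_smul w v.2⟩) ?_ ?_ ?_).symm
  · exact fun v hv => Face.smul_le_smul w hv
  · exact fun v v' _ _ h => Subtype.ext (MulAction.injective w (congrArg Subtype.val h))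
  · exact fun v hv => ⟨⟨w⁻¹ • v.1, isAtom_smul _ v.2⟩, (Face.le_smul_iff w).1 hv,
      Subtype.ext (smul_inv_smul w v.1)⟩

/-- By transitivity every chamber has as many vertices as C, which is the number of labels, so
injectivity on a chamber gives bijectivity. -/
theorem IsLabelling.bijectiveOnChambers [FiniteDimensional ℝ V] [Finite W] {I : Type*}
    {C : Chamber W} {τ : Vertex W → I} (hτ : IsLabelling C τ) : BijectiveOnChambers τ := by
  intro D
  have := hτ.finite
  have hinj : Set.InjOn τ D.1.vertices := fun v hv v' hv' h => by
    by_contra hne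
    exact hτ.ne_of_edge v v' hne ⟨D.1, hv, hv'⟩ h
  refine ⟨fun _ _ => Set.mem_univ _, hinj, Eq.ge ?_⟩
  refine Set.eq_of_subset_of_ncard_le (Set.subset_univ _) ?_
  obtain ⟨w, rfl⟩ := exists_smul_eq C D
  rw [Set.ncard_univ, hinj.ncard_image, ncard_vertices_smul, hτ.card_eq, Chamber.rank]

theorem beta_eq_betaChambers [FiniteDimensional ℝ V] (hW : IsFiniteReflectionGroup W) {I : Type*}
    (τ : Vertex W → I) (C : Chamber W) (J : Finset I) : beta τ C J = betaChambers τ C J := by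
  have := hW.finite
  refine Set.ncard_congr (fun w _ => w • C) (fun w hw => hw) ?_ ?_
  · intro w w' _ _ h
    have h1 : (w'⁻¹ * w) • C = C := by rw [mul_smul, h, inv_smul_smul]
    exact (inv_mul_eq_one.1 (eq_one_of_smul_eq hW h1)).symm
  · intro D hD
    obtain ⟨w, rfl⟩ := exists_smul_eq C D
    exact ⟨w, hD, rfl⟩

end CoxeterComplex

end

theorem mainTheorem12 {V : Type*} [NormedAddCommGroup V] [InnerProductSpace ℝ V]
    [FiniteDimensional ℝ V] (W : Subgroup (V ≃ₗᵢ[ℝ] V))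
    (hW : CoxeterComplex.IsFiniteReflectionGroup W) (C : CoxeterComplex.Chamber W) :
    (∃ τ : CoxeterComplex.Vertex W → Fin C.rank, CoxeterComplex.IsLabelling C τ) ∧
    ∀ {I : Type*} [DecidableEq I] (τ : CoxeterComplex.Vertex W → I),
      CoxeterComplex.IsLabelling C τ → ∀ J : Finset I,
        (CoxeterComplex.beta τ C J : ℤ) = CoxeterComplex.hVector τ J ∧
        (CoxeterComplex.betaChambers τ C J : ℤ) = CoxeterComplex.hVector τ J := by
  have := hW.finite
  refine ⟨CoxeterComplex.exists_isLabelling hW C, fun τ hτ J => ?_⟩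
  have := hτ.finite
  have h := CoxeterComplex.betaChambers_eq_hVector hτ.bijectiveOnChambers C J
  exact ⟨by rw [CoxeterComplex.beta_eq_betaChambers hW, h], h⟩
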